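/- Work in first-order logic with equality over the language $\{\in\}$ of set theory. The class $\Delta_0=\Sigma_0=\Pi_0$ is the least class of formulas containing the atomic formulas and closed under the propositional connectives and the bounded quantifiers $\forall x\in y$, $\exists x\in y$ ($x,y$ distinct variables); a $\Sigma_{k+1}$-formula is a (possibly empty) block of existential quantifiers followed by a $\Pi_k$-formula, and a $\Pi_{k+1}$-formula is a (possibly empty) block of universal quantifiers followed by a $\Sigma_k$-formula. Let $\mathbf{M}$ be the theory with axioms extensionality, empty set, pair, union, set difference, powerset, transitive containment (every set is included in a transitive set), infinity, set foundation (every non-empty set $z$ has a member disjoint from $z$), and the scheme of $\Delta_0$-separation. Let $\mathrm{Mac}$ be $\mathbf{M}$ together with the axiom of choice. For $k\in\mathbb{N}$: - $\Pi_k$-collection is the scheme, over all $\Pi_k$-formulas $\phi(x,y,\vec z)$, $$\forall\vec z\,\forall w\,\bigl((\forall x\in w)\,\exists y\,\phi(x,y,\vec z)\Rightarrow\exists C\,(\forall x\in w)(\exists y\in C)\,\phi(x,y,\vec z)\bigr);$$ - strong $\Pi_k$-collection is the scheme, over all $\Pi_k$-formulas $\phi(x,y,\vec z)$, $$\forall\vec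 z\,\forall w\,\exists C\,(\forall x\in w)\bigl(\exists y\,\phi(x,y,\vec z)\Rightarrow(\exists y\in C)\,\phi(x,y,\vec z)\bigr).$$ For a class $\Gamma$ of formulas, a theory $S$ is $\Gamma$-conservative over a theory $T$ if $S$ and $T$ prove the same sentences belonging to $\Gamma$. **Theorem.** Let $m\ge 1$. (I) The theory $\mathbf{M}+\Pi_{m+1}\text{-collection}$ is $\Pi_{m+3}$-conservative over the theory $\mathbf{M}+\text{strong }\Pi_m\text{-collection}$. (II) The theory $\mathrm{Mac}+\Pi_{m+1}\text{-collection}$ is $\Pi_{m+3}$-conservative over the theory $\mathrm{Mac}+\text{strong }\Pi_m\text{-collection}$. -/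

import Mathlib

open FirstOrder FirstOrder.Language

namespace FirstOrder.Language

/-! ### Provability in first-order logic -/

section Provability

variable {L : Language} {α : Type}

/-- The substitution used by `BoundedFormula.inst`: among the bound variables `0, …, k` in scope,
the outermost one, `0`, is replaced by the term `t`, and the others are renumbered. -/
def instVar (t : L.Term α) {k : ℕ} : α ⊕ Fin (k + 1) → L.Term (α ⊕ Fin k) :=
  Sum.elim (fun a => Term.var (Sum.inl a))
    (Fin.cases (t.relabel Sum.inl) fun i => Term.var (Sum.inr i))

/-- `φ.inst t` is `φ` with the outermost bound variable in scope replaced by the term `t`. For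
`φ : L.BoundedFormula α 1`, the body of the quantified formula `∀ x, φ(x)`, it is `φ(t)`. No
variable of `t` can be captured, since `t` contains free variables only. -/
def BoundedFormula.inst (t : L.Term α) :
    ∀ {k : ℕ}, L.BoundedFormula α (k + 1) → L.BoundedFormula α k
  | _, .falsum => .falsum
  | _, .equal s u => .equal (s.subst (instVar t)) (u.subst (instVar t))
  | _, .rel R ts => .rel R fun i => (ts i).subst (instVar t)
  | _, .imp φ ψ => .imp (φ.inst t) (ψ.inst t)
  | _, .all φ => .all (φ.inst t)

/-- Classical natural deduction for first-order logic with equality: `Derivable Γ φ` means that `φ`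
is derivable from the formulas in `Γ`. Formulas have free variables `0, 1, 2, …`; the primitive
connectives are `⊥`, `→` and `∀`, and `¬ φ` is `φ → ⊥`. -/
inductive Derivable : Set (L.Formula ℕ) → L.Formula ℕ → Prop
  | assumption {Γ φ} : φ ∈ Γ → Derivable Γ φ
  | weakening {Γ Δ φ} : Γ ⊆ Δ → Derivable Γ φ → Derivable Δ φ
  | impIntro {Γ} {φ ψ : L.Formula ℕ} : Derivable (insert φ Γ) ψ → Derivable Γ (φ.imp ψ)
  | impElim {Γ} {φ ψ : L.Formula ℕ} : Derivable Γ (φ.imp ψ) → Derivable Γ φ → Derivable Γ ψ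
  | byContradiction {Γ} {φ : L.Formula ℕ} : Derivable (insert φ.not Γ) ⊥ → Derivable Γ φ
  | allIntro {Γ} {φ : L.BoundedFormula ℕ 1} (x : ℕ)
      (hΓ : ∀ ψ ∈ Γ, x ∉ ψ.freeVarFinset) (hφ : x ∉ φ.freeVarFinset) :
      Derivable Γ (φ.inst (Term.var x)) → Derivable Γ φ.all
  | allElim {Γ} {φ : L.BoundedFormula ℕ 1} (t : L.Term ℕ) :
      Derivable Γ φ.all → Derivable Γ (φ.inst t)
  | eqRefl {Γ} (t : L.Term ℕ) : Derivable Γ (t.equal t)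
  | eqSubst {Γ} {φ : L.BoundedFormula ℕ 1} (s t : L.Term ℕ) :
      Derivable Γ (s.equal t) → Derivable Γ (φ.inst s) → Derivable Γ (φ.inst t)

/-- A sentence, regarded as a formula in which none of the variables `0, 1, 2, …` is free. -/
def Sentence.toFormulaNat (σ : L.Sentence) : L.Formula ℕ :=
  Formula.relabel Empty.elim σ

/-- The theory `T` proves the sentence `σ`. -/
def Theory.Proves (T : L.Theory) (σ : L.Sentence) : Prop :=
  Derivable (Sentence.toFormulaNat '' T) (Sentence.toFormulaNat σ)

/-- `S` is `Γ`-conservative over `T`: the theories `S` and `T` prove the same sentences of the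
class `Γ`. -/
def Theory.ConservativeOver (Γ : L.Sentence → Prop) (S T : L.Theory) : Prop :=
  ∀ σ : L.Sentence, Γ σ → (S.Proves σ ↔ T.Proves σ)

end Provability

end FirstOrder.Language

namespace WeakSetTheory

/-! ### The language of set theory and the Lévy classes -/

/-- The only relation symbol of the language of set theory: the binary symbol `∈`. -/
inductive MemRel : ℕ → Type
  | mem : MemRel 2

/-- The language of set theory. -/
def Lset : Language := ⟨fun _ => Empty, MemRel⟩

/-- The membership symbol. -/
abbrev memSymb : Lset.Relations 2 := MemRel.mem

/-- The atomic formula `s ∈ t`. -/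
def memF {α : Type} {n : ℕ} (s t : Lset.Term (α ⊕ Fin n)) : Lset.BoundedFormula α n :=
  memSymb.boundedFormula₂ s t

local infix:88 " ∈' " => memF

/-- The guard `x ∈ y` of a bounded quantifier: `x` is the newly bound variable and `y` is a
variable, free or bound, from outside the scope of that quantifier. -/
def guard {α : Type} {n : ℕ} (y : α ⊕ Fin n) : Lset.BoundedFormula α (n + 1) :=
  &(Fin.last n) ∈' Term.var (Sum.map id Fin.castSucc y)

/-- The `Δ₀` formulas: the least class that contains the atomic formulas and is closed under the
connectives and under the bounded quantifiers `∀ x ∈ y` and `∃ x ∈ y`, for distinct `x` and `y`. -/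
inductive IsDelta0 {α : Type} : ∀ {n : ℕ}, Lset.BoundedFormula α n → Prop
  | atomic {n} {φ : Lset.BoundedFormula α n} : φ.IsAtomic → IsDelta0 φ
  | falsum {n} : IsDelta0 (⊥ : Lset.BoundedFormula α n)
  | imp {n} {φ ψ : Lset.BoundedFormula α n} : IsDelta0 φ → IsDelta0 ψ → IsDelta0 (φ.imp ψ)
  | ball {n} (y : α ⊕ Fin n) {φ : Lset.BoundedFormula α (n + 1)} :
      IsDelta0 φ → IsDelta0 (∀' (guard y ⟹ φ))
  | bex {n} (y : α ⊕ Fin n) {φ : Lset.BoundedFormula α (n + 1)} :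
      IsDelta0 φ → IsDelta0 (∃' (guard y ⊓ φ))

/-- The two sides of the Lévy hierarchy. -/
inductive Side
  | sigma
  | pi

/-- `IsLevy .sigma k` is the class `Σ_k` and `IsLevy .pi k` the class `Π_k` of the Lévy hierarchy:
`Σ_0 = Π_0 = Δ₀`, a `Σ_{k+1}` formula is a (possibly empty) block of existential quantifiers in
front of a `Π_k` formula, and a `Π_{k+1}` formula is a (possibly empty) block of universal
quantifiers in front of a `Σ_k` formula. -/
inductive IsLevy {α : Type} : Side → ℕ → ∀ {n : ℕ}, Lset.BoundedFormula α n → Prop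
  | delta0 (s : Side) {n} {φ : Lset.BoundedFormula α n} : IsDelta0 φ → IsLevy s 0 φ
  | sigma_of_pi {k n} {φ : Lset.BoundedFormula α n} : IsLevy .pi k φ → IsLevy .sigma (k + 1) φ
  | pi_of_sigma {k n} {φ : Lset.BoundedFormula α n} : IsLevy .sigma k φ → IsLevy .pi (k + 1) φ
  | ex {k n} {φ : Lset.BoundedFormula α (n + 1)} :
      IsLevy .sigma (k + 1) φ → IsLevy .sigma (k + 1) (∃' φ)
  | all {k n} {φ : Lset.BoundedFormula α (n + 1)} :
      IsLevy .pi (k + 1) φ → IsLevy .pi (k + 1) (∀' φ)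

/-- The class `Π_k` of formulas with free variables from `α`. -/
def IsPi (k : ℕ) {α : Type} (φ : Lset.Formula α) : Prop :=
  IsLevy .pi k φ

/-! ### Axiom schemes

A scheme ranges over formulas `φ(x, z)` or `φ(x, y, z)` whose parameters `z` are the free variables
indexed by `Fin p`, and whose distinguished variables are indexed by `Fin 1` or `Fin 2`. The
variables that the axiom itself quantifies are the bound variables `&0, &1, …`, numbered from the
outermost quantifier inwards. -/

/-- `φ` with its distinguished variables replaced by the bound variables listed in `v`. -/
def plug {p k n : ℕ} (φ : Lset.Formula (Fin p ⊕ Fin k)) (v : Fin k → Fin n) :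
    Lset.BoundedFormula (Fin p) n :=
  BoundedFormula.relabel (Sum.map id v) φ

/-- Universal closure with respect to the parameters. -/
def closure {p : ℕ} (φ : Lset.Formula (Fin p)) : Lset.Sentence :=
  BoundedFormula.alls (n := p)
    (BoundedFormula.relabel (Sum.inr : Fin p → Empty ⊕ Fin p) φ)

/-- `∀ w ∃ y ∀ x (x ∈ y ↔ x ∈ w ∧ φ(x, z))`, with `w = &0`, `y = &1`, `x = &2`. -/
def separationInstance {p : ℕ} (φ : Lset.Formula (Fin p ⊕ Fin 1)) : Lset.Formula (Fin p) :=
  ∀' ∃' ∀' (&2 ∈' &1 ⇔ (&2 ∈' &0 ⊓ plug φ ![2]))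

/-- `∀ w ((∀ x ∈ w) ∃ y φ(x, y, z) → ∃ C (∀ x ∈ w) (∃ y ∈ C) φ(x, y, z))`, with `w = &0` and, in
the premise, `x = &1`, `y = &2`, in the conclusion `C = &1`, `x = &2`, `y = &3`. -/
def collectionInstance {p : ℕ} (φ : Lset.Formula (Fin p ⊕ Fin 2)) : Lset.Formula (Fin p) :=
  ∀' ((∀' (&1 ∈' &0 ⟹ ∃' (plug φ ![1, 2]))) ⟹
    ∃' ∀' (&2 ∈' &0 ⟹ ∃' (&3 ∈' &1 ⊓ plug φ ![2, 3])))

/-- `∀ w ∃ C (∀ x ∈ w) (∃ y φ(x, y, z) → (∃ y ∈ C) φ(x, y, z))`, with `w = &0`, `C = &1`, `x = &2`,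
`y = &3`. -/
def strongCollectionInstance {p : ℕ} (φ : Lset.Formula (Fin p ⊕ Fin 2)) : Lset.Formula (Fin p) :=
  ∀' ∃' ∀' (&2 ∈' &0 ⟹ (∃' (plug φ ![2, 3]) ⟹ ∃' (&3 ∈' &1 ⊓ plug φ ![2, 3])))

/-- `Δ₀`-separation. -/
def delta0Separation : Lset.Theory :=
  {σ | ∃ (p : ℕ) (φ : Lset.Formula (Fin p ⊕ Fin 1)),
    IsDelta0 φ ∧ σ = closure (separationInstance φ)}

/-- `Π_k`-collection. -/
def piCollection (k : ℕ) : Lset.Theory :=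
  {σ | ∃ (p : ℕ) (φ : Lset.Formula (Fin p ⊕ Fin 2)),
    IsPi k φ ∧ σ = closure (collectionInstance φ)}

/-- Strong `Π_k`-collection. -/
def strongPiCollection (k : ℕ) : Lset.Theory :=
  {σ | ∃ (p : ℕ) (φ : Lset.Formula (Fin p ⊕ Fin 2)),
    IsPi k φ ∧ σ = closure (strongCollectionInstance φ)}

/-! ### Single axioms -/

/-- `∀ x y (∀ z (z ∈ x ↔ z ∈ y) → x = y)` -/
def extensionality : Lset.Sentence :=
  ∀' ∀' ((∀' (&2 ∈' &0 ⇔ &2 ∈' &1)) ⟹ (&0 =' &1))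

/-- `∃ x ∀ y, y ∉ x` -/
def emptySet : Lset.Sentence :=
  ∃' ∀' ∼(&1 ∈' &0)

/-- `∀ x y ∃ z ∀ u (u ∈ z ↔ u = x ∨ u = y)` -/
def pairing : Lset.Sentence :=
  ∀' ∀' ∃' ∀' (&3 ∈' &2 ⇔ ((&3 =' &0) ⊔ (&3 =' &1)))

/-- `∀ x ∃ y ∀ z (z ∈ y ↔ ∃ u (u ∈ x ∧ z ∈ u))` -/
def union : Lset.Sentence :=
  ∀' ∃' ∀' (&2 ∈' &1 ⇔ ∃' (&3 ∈' &0 ⊓ &2 ∈' &3))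

/-- `∀ x y ∃ z ∀ u (u ∈ z ↔ u ∈ x ∧ u ∉ y)` -/
def setDifference : Lset.Sentence :=
  ∀' ∀' ∃' ∀' (&3 ∈' &2 ⇔ (&3 ∈' &0 ⊓ ∼(&3 ∈' &1)))

/-- `∀ x ∃ y ∀ z (z ∈ y ↔ ∀ u (u ∈ z → u ∈ x))` -/
def powerset : Lset.Sentence :=
  ∀' ∃' ∀' (&2 ∈' &1 ⇔ ∀' (&3 ∈' &2 ⟹ &3 ∈' &0))

/-- Transitive containment:
`∀ x ∃ y ((∀ u ∈ y) (∀ v ∈ u) v ∈ y ∧ (∀ u ∈ x) u ∈ y)` -/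
def transitiveContainment : Lset.Sentence :=
  ∀' ∃' ((∀' (&2 ∈' &1 ⟹ ∀' (&3 ∈' &2 ⟹ &3 ∈' &1))) ⊓
    (∀' (&2 ∈' &0 ⟹ &2 ∈' &1)))

/-- Infinity: some set contains the empty set and is closed under `y ↦ y ∪ {y}`, that is,
`∃ x ((∃ y ∈ x) ∀ u, u ∉ y ∧ (∀ y ∈ x) (∃ z ∈ x) ∀ u (u ∈ z ↔ u ∈ y ∨ u = y))` -/
def infinity : Lset.Sentence :=
  ∃' ((∃' (&1 ∈' &0 ⊓ ∀' ∼(&2 ∈' &1))) ⊓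
    (∀' (&1 ∈' &0 ⟹ ∃' (&2 ∈' &0 ⊓ ∀' (&3 ∈' &2 ⇔ (&3 ∈' &1 ⊔ (&3 =' &1)))))))

/-- Set foundation: `∀ z (∃ x (x ∈ z) → ∃ y (y ∈ z ∧ (∀ x ∈ y) x ∉ z))` -/
def setFoundation : Lset.Sentence :=
  ∀' ((∃' (&1 ∈' &0)) ⟹ ∃' (&1 ∈' &0 ⊓ ∀' (&2 ∈' &1 ⟹ ∼(&2 ∈' &0))))

/-- The axiom of choice: for every set `x` of nonempty, pairwise disjoint sets there is a set `c`
that has exactly one element in common with each member of `x`. -/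
def choice : Lset.Sentence :=
  ∀' (((∀' (&1 ∈' &0 ⟹ ∃' (&2 ∈' &1))) ⊓
      (∀' ∀' ((&1 ∈' &0 ⊓ &2 ∈' &0) ⟹ (∃' (&3 ∈' &1 ⊓ &3 ∈' &2)) ⟹ (&1 =' &2)))) ⟹
    ∃' ∀' (&2 ∈' &0 ⟹ ∃' ((&3 ∈' &1 ⊓ &3 ∈' &2) ⊓
      ∀' ((&4 ∈' &1 ⊓ &4 ∈' &2) ⟹ (&4 =' &3)))))

/-! ### The base theories -/

/-- `S₁`: extensionality, empty set, pair, union, set difference and powerset. -/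
def S1 : Lset.Theory :=
  {extensionality, emptySet, pairing, union, setDifference, powerset}

/-- `M`: `S₁` with transitive containment, infinity, `Δ₀`-separation and set foundation. -/
def theoryM : Lset.Theory :=
  S1 ∪ {transitiveContainment, infinity, setFoundation} ∪ delta0Separation

/-- `Mac`: `M` with the axiom of choice. -/
def theoryMac : Lset.Theory :=
  theoryM ∪ {choice}

end WeakSetTheory

/-! By soundness and completeness both theories may be compared through their models. One direction
is elementary: `HasCollection.hasStrongCollection` derives strong Π_m-collection from
Π_{m+1}-collection. For the other, a Π_{m+3} sentence σ that fails in a model M of the weaker theory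
has to fail in some model of the stronger one.

Fix values in M of the outer universal quantifiers of σ at which the remaining Σ_{m+2} formula χ is
false. In M there are arbitrarily long finite chains of transitive sets above these values, each set
containing all subsets of its predecessor and witnesses for more and more Σ_{m+1} statements about
it. In an ultrapower N of M (`IsModelM.exists_isDescending`) such chains acquire nonstandard length,
and reading one of them downwards from its top gives an external sequence D 0, D 1, …, all of whose
terms lie in one set H of N that is linearly ordered by membership. The required model is the
intersection of the D j, the core.

Two facts make the core work. First, by strong collection every relation up to level m + 1 agrees
with a Δ₀ relation with parameters on the members of a given set (`IsModelM.exists_d0`). Second,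
there is an underspill principle (`IsDescending.exists_core`): a Δ₀ property of every D j holds of
some member of the core, namely of an ∈-minimal element of H with that property.

Together they show that the core is Σ_{m+1}-elementary in N (`IsDescending.realize_iff`) and
satisfies Π_{m+1}-collection (`IsDescending.hasCollection_core`): if each member of w has a witness
in the core, then every D j contains witnesses for all of w, hence so does some set of the core. The
axioms of the base theory pass to the core as well. Finally, Σ_{m+2} formulas true in the core are
true in N, so χ stays false in the core and σ fails there. -/

namespace FirstOrder.Language

/-! ### Soundness of natural deduction, and free variables of sentences. -/

section Soundness

variable {L : Language} {α : Type} {M : Type*} [L.Structure M]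

theorem realize_subst_instVar (t : L.Term α) {k : ℕ} (s : L.Term (α ⊕ Fin (k + 1))) (v : α → M)
    (xs : Fin k → M) :
    (s.subst (instVar t)).realize (Sum.elim v xs) =
      s.realize (Sum.elim v (Fin.cons (t.realize v) xs)) := by
  rw [Term.realize_subst]
  congr 1
  funext i
  rcases i with a | i
  · rfl
  · refine Fin.cases ?_ (fun i => ?_) i
    · simp [instVar, Term.realize_relabel]
    · simp [instVar]

theorem BoundedFormula.realize_inst (t : L.Term α) (v : α → M) :
    ∀ {k : ℕ} (φ : L.BoundedFormula α (k + 1)) (xs : Fin k → M),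
      (φ.inst t).Realize v xs ↔ φ.Realize v (Fin.cons (t.realize v) xs : Fin (k + 1) → M)
  | _, .falsum, _ => by simp only [BoundedFormula.inst, BoundedFormula.Realize]
  | _, .equal s u, xs => by
    simp only [BoundedFormula.inst, BoundedFormula.Realize, realize_subst_instVar]
  | _, .rel R ts, xs => by
    simp only [BoundedFormula.inst, BoundedFormula.Realize, realize_subst_instVar]
  | _, .imp φ ψ, xs => by
    simp only [BoundedFormula.inst, BoundedFormula.Realize, realize_inst t v φ, realize_inst t v ψ]
  | _, .all φ, xs => by
    simp only [BoundedFormula.inst, BoundedFormula.Realize, realize_inst t v φ,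
      Fin.cons_snoc_eq_snoc_cons]

theorem Formula.realize_inst (t : L.Term α) (v : α → M) (φ : L.BoundedFormula α 1) :
    Formula.Realize (φ.inst t) v ↔ φ.Realize v (fun _ => t.realize v) := by
  rw [Formula.Realize, BoundedFormula.realize_inst]
  refine iff_of_eq (congrArg _ ?_)
  funext i
  rw [Fin.eq_zero i]
  rfl

theorem Formula.realize_all (v : α → M) (φ : L.BoundedFormula α 1) :
    Formula.Realize φ.all v ↔ ∀ a : M, φ.Realize v (fun _ => a) := by
  rw [Formula.Realize, BoundedFormula.realize_all]
  refine forall_congr' fun a => iff_of_eq (congrArg _ ?_)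
  funext i
  rw [show i = Fin.last 0 from Fin.eq_zero i, Fin.snoc_last]

theorem Term.realize_congr_varFinsetLeft [DecidableEq α] {k : ℕ} (t : L.Term (α ⊕ Fin k))
    {v w : α → M} (h : ∀ a ∈ t.varFinsetLeft, v a = w a) (xs : Fin k → M) :
    t.realize (Sum.elim v xs) = t.realize (Sum.elim w xs) := by
  induction t with
  | var i => rcases i with a | i <;> simp_all [Term.varFinsetLeft]
  | func f ts ih =>
    simp only [Term.realize]
    congr 1
    funext i
    exact ih i fun a ha => h a (by simp only [Term.varFinsetLeft, Finset.mem_biUnion]; exact ⟨i, by simp, ha⟩)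

theorem BoundedFormula.realize_congr_freeVarFinset [DecidableEq α] {k : ℕ}
    (φ : L.BoundedFormula α k) {v w : α → M} (h : ∀ a ∈ φ.freeVarFinset, v a = w a)
    (xs : Fin k → M) : φ.Realize v xs ↔ φ.Realize w xs := by
  induction φ with
  | falsum => rfl
  | equal s t =>
    simp only [freeVarFinset, Finset.mem_union] at h
    simp only [Realize, s.realize_congr_varFinsetLeft fun a ha => h a (.inl ha),
      t.realize_congr_varFinsetLeft fun a ha => h a (.inr ha)]
  | rel R ts =>
    simp only [freeVarFinset, Finset.mem_biUnion] at h
    simp only [Realize,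
      fun i => (ts i).realize_congr_varFinsetLeft fun a ha => h a ⟨i, Finset.mem_univ i, ha⟩]
  | imp φ ψ ih₁ ih₂ =>
    simp only [freeVarFinset, Finset.mem_union] at h
    simp only [Realize, ih₁ fun a ha => h a (.inl ha), ih₂ fun a ha => h a (.inr ha)]
  | all φ ih => simp only [Realize, ih h]

theorem Derivable.sound {Γ : Set (L.Formula ℕ)} {φ : L.Formula ℕ} (h : Derivable Γ φ) (v : ℕ → M)
    (hv : ∀ ψ ∈ Γ, ψ.Realize v) : φ.Realize v := by
  induction h generalizing v with
  | assumption h => exact hv _ h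
  | weakening hΓ _ ih => exact ih v fun ψ hψ => hv ψ (hΓ hψ)
  | impIntro _ ih =>
    refine Formula.realize_imp.2 fun h => ih v ?_
    rintro ψ (rfl | hψ)
    exacts [h, hv ψ hψ]
  | impElim _ _ ih₁ ih₂ => exact Formula.realize_imp.1 (ih₁ v hv) (ih₂ v hv)
  | byContradiction _ ih =>
    by_contra h
    refine ih v ?_
    rintro ψ (rfl | hψ)
    exacts [Formula.realize_not.2 h, hv ψ hψ]
  | @allIntro Γ φ x hΓ hφ _ ih =>
    rw [Formula.realize_all]
    intro a
    -- Reassigning the eigenvariable affects neither the hypotheses nor the body of the quantified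
    -- formula.
    have key (ψ : L.Formula ℕ) (hψ : x ∉ ψ.freeVarFinset) :
        ∀ b ∈ ψ.freeVarFinset, Function.update v x a b = v b := fun b hb =>
      Function.update_of_ne (fun h : b = x => hψ (h ▸ hb)) _ _
    have := (Formula.realize_inst _ _ _).1 (ih (Function.update v x a) fun ψ hψ =>
      (BoundedFormula.realize_congr_freeVarFinset ψ (key ψ (hΓ ψ hψ)) _).2 (hv ψ hψ))
    simp only [Term.realize_var, Function.update_self] at this
    refine (BoundedFormula.realize_congr_freeVarFinset φ ?_ _).1 this
    exact fun b hb => Function.update_of_ne (fun h : b = x => hφ (h ▸ hb)) _ _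
  | allElim t _ ih => exact (Formula.realize_inst _ _ _).2 ((Formula.realize_all _ _).1 (ih v hv) _)
  | eqRefl t => exact Formula.realize_equal.2 rfl
  | eqSubst s t _ _ ih₁ ih₂ =>
    have h := (Formula.realize_inst _ _ _).1 (ih₂ v hv)
    rw [Formula.realize_equal.1 (ih₁ v hv)] at h
    exact (Formula.realize_inst _ _ _).2 h

theorem Sentence.realize_toFormulaNat (σ : L.Sentence) (v : ℕ → M) :
    (Sentence.toFormulaNat σ).Realize v ↔ M ⊨ σ := by
  rw [Sentence.toFormulaNat, Formula.realize_relabel, Sentence.Realize]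
  exact iff_of_eq (congrArg _ (Subsingleton.elim _ _))

theorem Theory.Proves.sound {T : L.Theory} {σ : L.Sentence} (h : T.Proves σ) [Nonempty M]
    [M ⊨ T] : M ⊨ σ := by
  obtain ⟨a⟩ := ‹Nonempty M›
  refine (Sentence.realize_toFormulaNat σ fun _ => a).1 (Derivable.sound h _ ?_)
  rintro _ ⟨τ, hτ, rfl⟩
  exact (Sentence.realize_toFormulaNat τ _).2 (T.realize_sentence_of_mem hτ)

theorem Term.varFinsetLeft_relabel_of_isEmpty [IsEmpty α] {β γ : Type} [DecidableEq β] {k : ℕ}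
    (t : L.Term (α ⊕ Fin k)) (g : α ⊕ Fin k → β ⊕ γ) (hg : ∀ i, (g (.inr i)).isRight) :
    (t.relabel g).varFinsetLeft = ∅ := by
  induction t with
  | var i =>
    rcases i with a | i
    · exact isEmptyElim a
    · have := hg i
      rw [Term.relabel]
      cases h : g (.inr i) with
      | inl b => simp [h] at this
      | inr b => rfl
  | func f ts ih =>
    refine Finset.eq_empty_of_forall_notMem fun b hb => ?_
    obtain ⟨i, -, hi⟩ := Finset.mem_biUnion.1 hb
    rw [ih] at hi
    exact absurd hi (Finset.notMem_empty b)

theorem BoundedFormula.freeVarFinset_relabel_of_isEmpty [IsEmpty α] {β : Type} [DecidableEq β]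
    {n k : ℕ} (φ : L.BoundedFormula α k) (g : α → β ⊕ Fin n) :
    (φ.relabel g).freeVarFinset = ∅ := by
  have hg {k : ℕ} : ∀ i, (relabelAux g k (.inr i)).isRight := fun i => rfl
  induction φ with
  | falsum => rfl
  | equal s t =>
    simp only [relabel, mapTermRel, freeVarFinset, Term.varFinsetLeft_relabel_of_isEmpty _ _ hg,
      Finset.union_empty]
  | rel R ts =>
    refine Finset.eq_empty_of_forall_notMem fun b hb => ?_
    obtain ⟨i, -, hi⟩ := Finset.mem_biUnion.1 hb
    rw [Term.varFinsetLeft_relabel_of_isEmpty _ _ hg] at hi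
    exact absurd hi (Finset.notMem_empty b)
  | imp φ ψ ih₁ ih₂ => simp only [relabel_imp, freeVarFinset, ih₁, ih₂, Finset.union_empty]
  | all φ ih => rw [relabel_all, freeVarFinset, ih]

/-- Needed so that a theory, however large, uses up no variables: fresh ones for the Henkin
construction then always exist. -/
theorem Sentence.freeVarFinset_toFormulaNat (σ : L.Sentence) :
    (Sentence.toFormulaNat σ).freeVarFinset = ∅ :=
  BoundedFormula.freeVarFinset_relabel_of_isEmpty σ _

end Soundness

end FirstOrder.Language

namespace FirstOrder.Language

/-! ### Extending consistent sets of formulas to Henkin sets. -/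

section Henkin

variable {L : Language}

theorem Derivable.mono {Γ Δ : Set (L.Formula ℕ)} {φ : L.Formula ℕ} (h : Derivable Γ φ)
    (hΓ : Γ ⊆ Δ) : Derivable Δ φ :=
  .weakening hΓ h

theorem Derivable.exists_finite {Γ : Set (L.Formula ℕ)} {φ : L.Formula ℕ} (h : Derivable Γ φ) :
    ∃ Δ ⊆ Γ, Δ.Finite ∧ Derivable Δ φ := by
  induction h with
  | @assumption Γ φ h =>
    exact ⟨{φ}, Set.singleton_subset_iff.2 h, Set.finite_singleton φ, .assumption rfl⟩
  | weakening hΓ _ ih =>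
    obtain ⟨Δ, hΔ, hf, hd⟩ := ih
    exact ⟨Δ, hΔ.trans hΓ, hf, hd⟩
  | @impIntro Γ φ ψ _ ih =>
    obtain ⟨Δ, hΔ, hf, hd⟩ := ih
    refine ⟨Δ \ {φ}, Set.sdiff_singleton_subset_iff.2 hΔ, hf.sdiff, .impIntro (hd.mono ?_)⟩
    rw [Set.insert_sdiff_singleton]
    exact Set.subset_insert _ _
  | impElim _ _ ih₁ ih₂ =>
    obtain ⟨Δ₁, hΔ₁, hf₁, hd₁⟩ := ih₁
    obtain ⟨Δ₂, hΔ₂, hf₂, hd₂⟩ := ih₂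
    exact ⟨Δ₁ ∪ Δ₂, Set.union_subset hΔ₁ hΔ₂, hf₁.union hf₂,
      .impElim (hd₁.mono Set.subset_union_left) (hd₂.mono Set.subset_union_right)⟩
  | @byContradiction Γ φ _ ih =>
    obtain ⟨Δ, hΔ, hf, hd⟩ := ih
    refine ⟨Δ \ {φ.not}, Set.sdiff_singleton_subset_iff.2 hΔ, hf.sdiff,
      .byContradiction (hd.mono ?_)⟩
    rw [Set.insert_sdiff_singleton]
    exact Set.subset_insert _ _
  | allIntro x hΓ hφ _ ih =>
    obtain ⟨Δ, hΔ, hf, hd⟩ := ih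
    exact ⟨Δ, hΔ, hf, .allIntro x (fun ψ hψ => hΓ ψ (hΔ hψ)) hφ hd⟩
  | allElim t _ ih =>
    obtain ⟨Δ, hΔ, hf, hd⟩ := ih
    exact ⟨Δ, hΔ, hf, .allElim t hd⟩
  | eqRefl t => exact ⟨∅, Set.empty_subset _, Set.finite_empty, .eqRefl t⟩
  | eqSubst s t _ _ ih₁ ih₂ =>
    obtain ⟨Δ₁, hΔ₁, hf₁, hd₁⟩ := ih₁
    obtain ⟨Δ₂, hΔ₂, hf₂, hd₂⟩ := ih₂
    exact ⟨Δ₁ ∪ Δ₂, Set.union_subset hΔ₁ hΔ₂, hf₁.union hf₂,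
      .eqSubst s t (hd₁.mono Set.subset_union_left) (hd₂.mono Set.subset_union_right)⟩

/-- A set of formulas is consistent if it does not derive `⊥`. -/
def Consistent (Γ : Set (L.Formula ℕ)) : Prop :=
  ¬ Derivable Γ ⊥

theorem Consistent.mono {Γ Δ : Set (L.Formula ℕ)} (h : Consistent Δ) (hΓ : Γ ⊆ Δ) :
    Consistent Γ :=
  fun hd => h (hd.mono hΓ)

theorem Consistent.insert_or {Γ : Set (L.Formula ℕ)} (h : Consistent Γ) (φ : L.Formula ℕ) :
    Consistent (insert φ Γ) ∨ Consistent (insert φ.not Γ) := by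
  by_contra! hc
  obtain ⟨h₁, h₂⟩ := hc
  exact h (.impElim (.impIntro (not_not.1 h₁)) (.byContradiction (not_not.1 h₂)))

/-- If `¬ ∀ x, φ(x)` is consistent with `Γ`, so is `¬ φ(x)` for a fresh variable `x`. -/
theorem Consistent.insert_not_inst {Γ : Set (L.Formula ℕ)} {φ : L.BoundedFormula ℕ 1}
    (h : Consistent Γ) (hφ : Formula.not φ.all ∈ Γ) {x : ℕ}
    (hx : ∀ ψ ∈ Γ, x ∉ ψ.freeVarFinset) :
    Consistent (insert (Formula.not (φ.inst (Term.var x))) Γ) := by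
  intro hd
  have hxφ : x ∉ φ.freeVarFinset := fun hxφ => hx _ hφ (by
    rw [Formula.not, BoundedFormula.not, BoundedFormula.freeVarFinset,
      BoundedFormula.freeVarFinset]
    exact Finset.mem_union_left _ hxφ)
  exact h (.impElim (.assumption hφ) (.allIntro x hx hxφ (.byContradiction hd)))

/-- A Henkin set: a consistent and complete set of formulas in which every false universal formula
has a variable as a counterexample. -/
structure IsHenkin (Δ : Set (L.Formula ℕ)) : Prop where
  consistent : Consistent Δ
  mem_or_not_mem : ∀ φ : L.Formula ℕ, φ ∈ Δ ∨ φ.not ∈ Δ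
  exists_inst : ∀ φ : L.BoundedFormula ℕ 1, Formula.not φ.all ∈ Δ →
    ∃ x : ℕ, Formula.not (φ.inst (Term.var x)) ∈ Δ

/-- Formulas of Γ are closed and F is finite, so some variable occurs free in none of them. It
serves as the counterexample whenever the formula just decided is a negated universal one, and no
new constants are required. -/
theorem Consistent.exists_henkin_step {Γ : Set (L.Formula ℕ)}
    (hΓ : ∀ ψ ∈ Γ, ψ.freeVarFinset = ∅) {F : Set (L.Formula ℕ)} (hF : F.Finite)
    (h : Consistent (Γ ∪ F)) (ψ : L.Formula ℕ) :
    ∃ F' : Set (L.Formula ℕ), F ⊆ F' ∧ F'.Finite ∧ Consistent (Γ ∪ F') ∧ (ψ ∈ F' ∨ ψ.not ∈ F') ∧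
      ∀ φ : L.BoundedFormula ℕ 1, ψ = Formula.not φ.all → ψ ∈ F' →
        ∃ x : ℕ, Formula.not (φ.inst (Term.var x)) ∈ F' := by
  by_cases hc : Consistent (insert ψ (Γ ∪ F))
  · by_cases hψ : ∃ φ : L.BoundedFormula ℕ 1, ψ = Formula.not φ.all
    · obtain ⟨φ, rfl⟩ := hψ
      have hfin : (insert (Formula.not φ.all) F).Finite := hF.insert _
      obtain ⟨x, hx⟩ := Infinite.exists_notMem_finset
        (hfin.toFinset.biUnion fun ψ => ψ.freeVarFinset)
      have hx' : ∀ ψ ∈ insert (Formula.not φ.all) (Γ ∪ F), x ∉ ψ.freeVarFinset := by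
        intro ψ hψ hxψ
        rw [← Set.union_insert] at hψ
        rcases hψ with hψ | hψ
        · rw [hΓ ψ hψ] at hxψ
          exact Finset.notMem_empty _ hxψ
        · exact hx (Finset.mem_biUnion.2 ⟨ψ, hfin.mem_toFinset.2 hψ, hxψ⟩)
      have hc' := hc.insert_not_inst (Set.mem_insert _ _) hx'
      refine ⟨insert (Formula.not (φ.inst (Term.var x))) (insert (Formula.not φ.all) F),
        fun a ha => .inr (.inr ha), hfin.insert _, ?_, .inl (.inr (.inl rfl)), ?_⟩
      · rwa [Set.union_insert, Set.union_insert]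
      · intro φ' hφ' _
        obtain rfl : φ = φ' := by
          simpa [Formula.not, BoundedFormula.not] using hφ'
        exact ⟨x, .inl rfl⟩
    · refine ⟨insert ψ F, Set.subset_insert _ _, hF.insert _, by rwa [Set.union_insert],
        .inl (.inl rfl), fun φ hφ => absurd ⟨φ, hφ⟩ hψ⟩
  · have hc' := (h.insert_or ψ).resolve_left hc
    rw [← Set.union_insert] at hc'
    refine ⟨insert ψ.not F, Set.subset_insert _ _, hF.insert _, hc', .inr (.inl rfl), ?_⟩
    rintro φ - (hψ | hψ)
    · exact absurd (Derivable.impElim (φ := ψ) (.assumption (.inr (.inl rfl)))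
        (.assumption (.inr (.inl hψ)))) hc'
    · exact absurd (h.mono (Set.insert_subset (.inr hψ) subset_rfl)) hc

/-- All formulas are decided one by one along an enumeration. A derivation of ⊥ from the union would
use finitely many formulas, hence only those of a single stage. -/
theorem Consistent.exists_isHenkin [Countable (L.Formula ℕ)] {Γ : Set (L.Formula ℕ)}
    (hΓ : ∀ ψ ∈ Γ, ψ.freeVarFinset = ∅) (h : Consistent Γ) : ∃ Δ, Γ ⊆ Δ ∧ IsHenkin Δ := by
  obtain ⟨e, he⟩ := exists_surjective_nat (L.Formula ℕ)
  let S := {F : Set (L.Formula ℕ) // F.Finite ∧ Consistent (Γ ∪ F)}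
  choose! next hnext using fun (F : S) (ψ : L.Formula ℕ) =>
    Consistent.exists_henkin_step hΓ F.2.1 F.2.2 ψ
  let f : ℕ → S := Nat.rec ⟨∅, Set.finite_empty, by rwa [Set.union_empty]⟩
    fun n F => ⟨next F (e n), (hnext F (e n)).2.1, (hnext F (e n)).2.2.1⟩
  have hf (n : ℕ) : (f (n + 1)).1 = next (f n) (e n) := rfl
  have hmono : Monotone fun n => (f n).1 :=
    monotone_nat_of_le_succ fun n => by rw [hf]; exact (hnext _ _).1
  have hmem (n : ℕ) : (f n).1 ⊆ Γ ∪ ⋃ n, (f n).1 := fun ψ hψ => .inr (Set.mem_iUnion.2 ⟨n, hψ⟩)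
  have hcons : Consistent (Γ ∪ ⋃ n, (f n).1) := by
    intro hd
    obtain ⟨Δ, hΔ, hfin, hd⟩ := hd.exists_finite
    have : ∃ n, Δ ⊆ Γ ∪ (f n).1 := by
      rw [Set.union_iUnion] at hΔ
      lift Δ to Finset (L.Formula ℕ) using hfin
      exact (Monotone.directed_le fun i j hij => Set.union_subset_union_right _
        (hmono hij)).exists_mem_subset_of_finset_subset_biUnion hΔ
    obtain ⟨n, hn⟩ := this
    exact (f n).2.2 (hd.mono hn)
  refine ⟨_, Set.subset_union_left, hcons, fun φ => ?_, fun φ hφ => ?_⟩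
  · obtain ⟨n, rfl⟩ := he φ
    exact (hnext (f n) (e n)).2.2.2.1.imp (fun h => hmem (n + 1) h) fun h => hmem (n + 1) h
  · obtain ⟨n, hn⟩ := he (Formula.not φ.all)
    rcases (hnext (f n) (e n)).2.2.2.1 with h | h
    · obtain ⟨x, hx⟩ := (hnext (f n) (e n)).2.2.2.2 φ hn h
      exact ⟨x, hmem (n + 1) hx⟩
    · refine absurd (.impElim (.assumption (hmem (n + 1) h)) (.assumption ?_)) hcons
      rwa [hn]

namespace IsHenkin

variable {Δ : Set (L.Formula ℕ)}

theorem mem_of_derivable (h : IsHenkin Δ) {φ : L.Formula ℕ} (hφ : Derivable Δ φ) : φ ∈ Δ :=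
  (h.mem_or_not_mem φ).resolve_right fun hn =>
    h.consistent (.impElim (.assumption hn) hφ)

theorem not_mem_iff (h : IsHenkin Δ) {φ : L.Formula ℕ} : φ.not ∈ Δ ↔ φ ∉ Δ :=
  ⟨fun hn hφ => h.consistent (.impElim (.assumption hn) (.assumption hφ)),
    (h.mem_or_not_mem φ).resolve_left⟩

theorem imp_mem_iff (h : IsHenkin Δ) {φ ψ : L.Formula ℕ} : φ.imp ψ ∈ Δ ↔ (φ ∈ Δ → ψ ∈ Δ) := by
  refine ⟨fun hi hφ => h.mem_of_derivable (.impElim (.assumption hi) (.assumption hφ)),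
    fun hi => h.mem_of_derivable (.impIntro ?_)⟩
  by_cases hφ : φ ∈ Δ
  · exact .assumption (.inr (hi hφ))
  · refine .byContradiction (.impElim (φ := φ) (.assumption ?_) (.assumption ?_))
    · exact .inr (.inr (h.not_mem_iff.2 hφ))
    · exact .inr (.inl rfl)

theorem all_mem_iff (h : IsHenkin Δ) {φ : L.BoundedFormula ℕ 1} :
    φ.all ∈ Δ ↔ ∀ x : ℕ, φ.inst (Term.var x) ∈ Δ := by
  refine ⟨fun ha x => h.mem_of_derivable (.allElim _ (.assumption ha)), fun ha => ?_⟩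
  by_contra hn
  obtain ⟨x, hx⟩ := h.exists_inst φ (h.not_mem_iff.2 hn)
  exact h.not_mem_iff.1 hx (ha x)

theorem mem_inst_of_eq (h : IsHenkin Δ) {φ : L.BoundedFormula ℕ 1} {x y : ℕ}
    (hxy : Term.equal (Term.var x) (Term.var y) ∈ Δ) (hφ : φ.inst (Term.var x) ∈ Δ) :
    φ.inst (Term.var y) ∈ Δ :=
  h.mem_of_derivable (.eqSubst _ _ (.assumption hxy) (.assumption hφ))

theorem eq_refl (h : IsHenkin Δ) (x : ℕ) : Term.equal (Term.var x) (Term.var x) ∈ Δ :=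
  h.mem_of_derivable (.eqRefl _)

theorem eq_symm (h : IsHenkin Δ) {x y : ℕ} (hxy : Term.equal (Term.var x) (Term.var y) ∈ Δ) :
    Term.equal (Term.var y) (Term.var x) ∈ Δ :=
  by
  -- Leibniz's rule for the formula `_ = x` turns `x = x` into `y = x`.
  have := h.mem_inst_of_eq (φ := .equal (.var (.inr 0)) (.var (.inl x))) hxy
  simp only [BoundedFormula.inst, instVar, Term.subst] at this
  exact this (h.eq_refl x)

theorem eq_trans (h : IsHenkin Δ) {x y z : ℕ} (hxy : Term.equal (Term.var x) (Term.var y) ∈ Δ)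
    (hyz : Term.equal (Term.var y) (Term.var z) ∈ Δ) :
    Term.equal (Term.var x) (Term.var z) ∈ Δ :=
  by
  have := h.mem_inst_of_eq (φ := .equal (.var (.inl x)) (.var (.inr 0))) hyz
  simp only [BoundedFormula.inst, instVar, Term.subst] at this
  exact this hxy

end IsHenkin

/-- The number of connectives and quantifiers of a formula. -/
def BoundedFormula.complexity {α : Type} : ∀ {n : ℕ}, L.BoundedFormula α n → ℕ
  | _, .falsum => 0
  | _, .equal _ _ => 0
  | _, .rel _ _ => 0
  | _, .imp φ ψ => φ.complexity + ψ.complexity + 1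
  | _, .all φ => φ.complexity + 1

/-- The truth lemma passes from `∀ x, φ` to the instances of `φ`, which are not subformulas
syntactically; this measure makes that a legitimate induction. -/
theorem BoundedFormula.complexity_inst {α : Type} (t : L.Term α) :
    ∀ {k : ℕ} (φ : L.BoundedFormula α (k + 1)), (φ.inst t).complexity = φ.complexity
  | _, .falsum => by simp only [inst, complexity]
  | _, .equal _ _ => by simp only [inst, complexity]
  | _, .rel _ _ => by simp only [inst, complexity]
  | _, .imp φ ψ => by simp only [inst, complexity, complexity_inst t φ, complexity_inst t ψ]
  | _, .all φ => by simp only [inst, complexity, complexity_inst t φ]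

end Henkin

end FirstOrder.Language

namespace WeakSetTheory

/-! ### The membership relation of a structure. -/

section Basic

variable {M : Type} [Lset.Structure M]

/-- The membership relation of a structure for the language of set theory. -/
def Mem (x y : M) : Prop :=
  Structure.RelMap memSymb ![x, y]

local infix:50 " ε " => Mem

/-- The structure for the language of set theory with a given membership relation. -/
@[reducible] def structureOfRel {N : Type} (r : N → N → Prop) : Lset.Structure N where
  funMap f := Empty.elim f
  RelMap {n} R := match n, R with | _, .mem => fun v => r (v 0) (v 1)

theorem relMap_mem (v : Fin 2 → M) : Structure.RelMap memSymb v ↔ v 0 ε v 1 := by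
  rw [Mem]
  refine iff_of_eq (congrArg _ ?_)
  funext i
  fin_cases i <;> rfl

@[simp]
theorem realize_memF {α : Type} {n : ℕ} (s t : Lset.Term (α ⊕ Fin n)) (v : α → M)
    (xs : Fin n → M) : (memF s t).Realize v xs ↔
      s.realize (Sum.elim v xs) ε t.realize (Sum.elim v xs) :=
  BoundedFormula.realize_rel₂

theorem exists_eq_var {α : Type} : ∀ t : Lset.Term α, ∃ i, t = Term.var i
  | .var i => ⟨i, rfl⟩
  | .func f _ => Empty.elim f

instance : Countable Lset.Symbols :=
  have : IsEmpty (Σ n, Lset.Functions n) := ⟨fun f => Empty.elim f.2⟩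
  have : Countable (Σ n, Lset.Relations n) :=
    Function.Injective.countable (f := fun R : Σ n, Lset.Relations n => R.1) (by
      rintro ⟨_, ⟨⟩⟩ ⟨_, ⟨⟩⟩ _
      rfl)
  inferInstanceAs (Countable ((Σ n, Lset.Functions n) ⊕ (Σ n, Lset.Relations n)))

end Basic

/-! ### The term model and the completeness theorem. -/

section Completeness

/-- The formula `x ∈ y` for variables `x` and `y`. -/
abbrev memVar (x y : ℕ) : Lset.Formula ℕ :=
  memF (Term.var (.inl x)) (Term.var (.inl y))

variable {Δ : Set (Lset.Formula ℕ)}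

theorem memVar_mem_congr (h : IsHenkin Δ) {x x' y y' : ℕ}
    (hx : Term.equal (Term.var x) (Term.var x') ∈ Δ)
    (hy : Term.equal (Term.var y) (Term.var y') ∈ Δ) (hm : memVar x y ∈ Δ) :
    memVar x' y' ∈ Δ := by
  have inst_left (z w : ℕ) : (memF (.var (.inr 0)) (.var (.inl w)) :
      Lset.BoundedFormula ℕ 1).inst (Term.var z) = memVar z w := by
    simp only [memVar, memF, Relations.boundedFormula₂, Relations.boundedFormula,
      BoundedFormula.inst]
    congr 1
    funext i
    fin_cases i <;> rfl
  have inst_right (z w : ℕ) : (memF (.var (.inl z)) (.var (.inr 0)) :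
      Lset.BoundedFormula ℕ 1).inst (Term.var w) = memVar z w := by
    simp only [memVar, memF, Relations.boundedFormula₂, Relations.boundedFormula,
      BoundedFormula.inst]
    congr 1
    funext i
    fin_cases i <;> rfl
  rw [← inst_left] at hm
  have h' := h.mem_inst_of_eq hx hm
  rw [inst_left, ← inst_right] at h'
  have h'' := h.mem_inst_of_eq hy h'
  rwa [inst_right] at h''

/-- Provable equality of variables. -/
def henkinSetoid (h : IsHenkin Δ) : Setoid ℕ where
  r x y := Term.equal (Term.var x) (Term.var y) ∈ Δ
  iseqv := ⟨h.eq_refl, h.eq_symm, h.eq_trans⟩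

/-- The term model of a Henkin set. -/
def HenkinModel (h : IsHenkin Δ) : Type :=
  Quotient (henkinSetoid h)

instance (h : IsHenkin Δ) : Lset.Structure (HenkinModel h) :=
  structureOfRel (Quotient.lift₂ (fun x y => memVar x y ∈ Δ) fun _ _ _ _ hx hy =>
    propext ⟨memVar_mem_congr h hx hy, memVar_mem_congr h (h.eq_symm hx) (h.eq_symm hy)⟩)

/-- The class of a variable in the term model. -/
def henkinVar (h : IsHenkin Δ) (x : ℕ) : HenkinModel h :=
  Quotient.mk (henkinSetoid h) x

/-- The truth lemma. With no function symbols every element of the term model is the class of a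
variable, so instances at variables exhaust the range of a quantifier. -/
theorem mem_iff_realize (h : IsHenkin Δ) (n : ℕ) (φ : Lset.Formula ℕ) (hn : φ.complexity ≤ n) :
    φ ∈ Δ ↔ φ.Realize (henkinVar h) := by
  induction n using Nat.strong_induction_on generalizing φ with
  | _ n ih =>
    match φ, hn with
    | .falsum, _ => exact iff_of_false (fun hf => h.consistent (.assumption hf)) id
    | .equal s t, _ =>
      obtain ⟨x | i, rfl⟩ := exists_eq_var s
      · obtain ⟨y | i, rfl⟩ := exists_eq_var t
        · exact (Quotient.eq (r := henkinSetoid h)).symm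
        · exact i.elim0
      · exact i.elim0
    | .rel (l := l) R ts, _ =>
      cases R with
      | mem =>
        obtain ⟨x | i, hx⟩ := exists_eq_var (ts 0)
        · obtain ⟨y | i, hy⟩ := exists_eq_var (ts 1)
          · have : ts = ![Term.var (.inl x), Term.var (.inl y)] := by
              funext i
              fin_cases i
              exacts [hx, hy]
            subst this
            rfl
          · exact i.elim0
        · exact i.elim0
    | .imp φ ψ, hn =>
      rw [BoundedFormula.complexity] at hn
      exact h.imp_mem_iff.trans ((imp_congr (ih φ.complexity (by omega) φ le_rfl)
        (ih ψ.complexity (by omega) ψ le_rfl)).trans Formula.realize_imp.symm)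
    | .all φ, hn =>
      rw [BoundedFormula.complexity] at hn
      rw [h.all_mem_iff, Formula.realize_all]
      refine Iff.trans (forall_congr' fun x => ?_)
        (Quotient.mk_surjective (s := henkinSetoid h)).forall.symm
      rw [ih φ.complexity (by omega) _ (BoundedFormula.complexity_inst _ φ).le,
        Formula.realize_inst]
      rfl

/-- **Completeness theorem** for the language of set theory. -/
theorem proves_of_forall_model {T : Lset.Theory} {σ : Lset.Sentence}
    (h : ∀ (M : Type) [Lset.Structure M] [Nonempty M], M ⊨ T → M ⊨ σ) : T.Proves σ := by
  refine .byContradiction ?_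
  by_contra hc
  obtain ⟨Δ, hΓ, hΔ⟩ := Consistent.exists_isHenkin (Γ := insert
    (Formula.not (Sentence.toFormulaNat σ)) (Sentence.toFormulaNat '' T)) (by
      rintro _ (rfl | ⟨τ, -, rfl⟩)
      · rw [Formula.not, BoundedFormula.not, BoundedFormula.freeVarFinset,
          Sentence.freeVarFinset_toFormulaNat]
        rfl
      · exact Sentence.freeVarFinset_toFormulaNat τ) hc
  have key (φ) (hφ : φ ∈ Δ) := (mem_iff_realize hΔ _ φ le_rfl).1 hφ
  have : Nonempty (HenkinModel hΔ) := ⟨henkinVar hΔ 0⟩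
  have hσ := key _ (hΓ (Set.mem_insert _ _))
  rw [Formula.realize_not, Sentence.realize_toFormulaNat] at hσ
  refine hσ (h _ ((Theory.model_iff _).2 fun τ hτ => ?_))
  exact (Sentence.realize_toFormulaNat τ _).1 (key _ (hΓ (.inr ⟨τ, hτ, rfl⟩)))

theorem proves_iff_forall_model {T : Lset.Theory} {σ : Lset.Sentence} :
    T.Proves σ ↔ ∀ (M : Type) [Lset.Structure M] [Nonempty M], M ⊨ T → M ⊨ σ :=
  ⟨fun h _ _ _ _ => h.sound, proves_of_forall_model⟩

end Completeness

end WeakSetTheory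

namespace WeakSetTheory

/-! ### Definable relations in place of formulas: the Lévy classes semantically. -/

section Semantic

variable {M : Type} {ι κ : Type}

/-- The assignment that extends `v` by the value `x` for the new variable `none`. -/
def scons (x : M) (v : ι → M) : Option ι → M :=
  fun o => o.elim x v

@[simp]
theorem scons_none (x : M) (v : ι → M) : scons x v none = x :=
  rfl

@[simp]
theorem scons_some (x : M) (v : ι → M) (i : ι) : scons x v (some i) = v i :=
  rfl

theorem scons_comp_map (x : M) (v : κ → M) (f : ι → κ) :
    scons x v ∘ Option.map f = scons x (v ∘ f) := by
  funext o
  cases o <;> rfl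

variable [Lset.Structure M]

local infix:50 " ε " => Mem

/-- The relations on a structure that are defined by `Δ₀` formulas. -/
inductive D0 : ∀ {ι : Type}, ((ι → M) → Prop) → Prop
  | mem {ι : Type} (i j : ι) : D0 fun v : ι → M => v i ε v j
  | eq {ι : Type} (i j : ι) : D0 fun v : ι → M => v i = v j
  | falsum {ι : Type} : D0 fun _ : ι → M => False
  | imp {ι : Type} {P Q : (ι → M) → Prop} : D0 P → D0 Q → D0 fun v => P v → Q v
  | ball_scons {ι : Type} (j : ι) {P : (Option ι → M) → Prop} :
      D0 P → D0 fun v : ι → M => ∀ x, x ε v j → P (scons x v)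

namespace D0

variable {P Q : (ι → M) → Prop}

theorem congr (h : D0 P) (hPQ : ∀ v, P v ↔ Q v) : D0 Q := by
  rwa [← show P = Q from funext fun v => propext (hPQ v)]

theorem not (h : D0 P) : D0 fun v => ¬ P v :=
  h.imp .falsum

theorem and (hP : D0 P) (hQ : D0 Q) : D0 fun v => P v ∧ Q v :=
  (hP.imp hQ.not).not.congr fun v => by tauto

theorem or (hP : D0 P) (hQ : D0 Q) : D0 fun v => P v ∨ Q v :=
  (hP.not.imp hQ).congr fun v => by tauto

/-- The form of `ball_scons` in which the bound variable is a separate argument of the matrix, as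
concrete relations are written. -/
theorem ball (j : ι) {R : (ι → M) → M → Prop}
    (h : D0 fun w : Option ι → M => R (fun i => w (some i)) (w none)) :
    D0 fun v => ∀ x, x ε v j → R v x :=
  .ball_scons j h

theorem bex (j : ι) {R : (ι → M) → M → Prop}
    (h : D0 fun w : Option ι → M => R (fun i => w (some i)) (w none)) :
    D0 fun v => ∃ x, x ε v j ∧ R v x :=
  (ball j (R := fun v x => ¬ R v x) h.not).not.congr fun v => by push Not; rfl

theorem relabel (h : D0 P) (f : ι → κ) : D0 fun v : κ → M => P fun i => v (f i) := by
  induction h generalizing κ with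
  | mem i j => exact .mem _ _
  | eq i j => exact .eq _ _
  | falsum => exact .falsum
  | imp _ _ ih₁ ih₂ => exact (ih₁ f).imp (ih₂ f)
  | ball_scons j _ ih =>
    refine (ball_scons (f j) (ih (Option.map f))).congr fun v => ?_
    exact forall₂_congr fun x _ => iff_of_eq (congrArg _ (scons_comp_map x v f))

/-- The axiom schemes speak of formulas, the arguments below of relations. This is the passage back
to formulas; `IsDelta0.d0` is the converse. -/
theorem exists_formula (h : D0 P) {α : Type} {n : ℕ} (f : ι → α ⊕ Fin n) :
    ∃ φ : Lset.BoundedFormula α n, IsDelta0 φ ∧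
      ∀ (v : α → M) xs, φ.Realize v xs ↔ P fun i => Sum.elim v xs (f i) := by
  induction h generalizing n with
  | mem i j => exact ⟨_, .atomic (.rel memSymb ![.var (f i), .var (f j)]), fun v xs =>
      realize_memF _ _ _ _⟩
  | eq i j => exact ⟨_, .atomic (.equal (.var (f i)) (.var (f j))), fun v xs =>
      BoundedFormula.realize_bdEqual _ _⟩
  | falsum => exact ⟨⊥, .falsum, fun v xs => BoundedFormula.realize_bot⟩
  | imp _ _ ih₁ ih₂ =>
    obtain ⟨φ, hφ, hφ'⟩ := ih₁ f
    obtain ⟨ψ, hψ, hψ'⟩ := ih₂ f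
    exact ⟨φ.imp ψ, hφ.imp hψ, fun v xs =>
      BoundedFormula.realize_imp.trans (imp_congr (hφ' v xs) (hψ' v xs))⟩
  | ball_scons j _ ih =>
    obtain ⟨φ, hφ, hφ'⟩ := ih fun o =>
      o.elim (.inr (Fin.last n)) fun i => Sum.map id Fin.castSucc (f i)
    refine ⟨_, .ball (f j) hφ, fun v xs => ?_⟩
    rw [BoundedFormula.realize_all]
    refine forall_congr' fun x => ?_
    have key (a : α ⊕ Fin n) : Sum.elim v (Fin.snoc xs x : Fin (n + 1) → M)
        (Sum.map id Fin.castSucc a) = Sum.elim v xs a := by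
      cases a <;> simp
    rw [BoundedFormula.realize_imp, guard, realize_memF]
    refine imp_congr (iff_of_eq ?_) ((hφ' _ _).trans (iff_of_eq (congrArg _ ?_)))
    · simp [key]
    · funext o
      cases o
      · simp
      · simp [key]

end D0

theorem realize_guard {α : Type} {n : ℕ} (y : α ⊕ Fin n) (v : α → M) (xs : Fin n → M) (x : M) :
    (guard y).Realize v (Fin.snoc xs x : Fin (n + 1) → M) ↔ x ε Sum.elim v xs y := by
  rw [guard, realize_memF]
  cases y <;> simp

theorem IsDelta0.d0 {α : Type} {n : ℕ} {φ : Lset.BoundedFormula α n} (h : IsDelta0 φ)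
    (f : α ⊕ Fin n → ι) :
    D0 fun w : ι → M => φ.Realize (fun a => w (f (.inl a))) fun i => w (f (.inr i)) := by
  have key {n : ℕ} (f : α ⊕ Fin n → ι) (w : ι → M) (i) :
      Sum.elim (fun a => w (f (.inl a))) (fun i => w (f (.inr i))) i = w (f i) := by
    cases i <;> rfl
  have key' {ι : Type} {n : ℕ} (f : α ⊕ Fin n → ι) (w : ι → M) (x : M) :
      (Fin.snoc (fun i => w (f (.inr i))) x : Fin (n + 1) → M) = fun i => scons x w
        (i.lastCases none fun i => some (f (.inr i))) := by
    funext i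
    refine Fin.lastCases ?_ (fun i => ?_) i <;> simp
  induction h generalizing ι with
  | @atomic n φ h =>
    cases h with
    | equal t₁ t₂ =>
      obtain ⟨i, rfl⟩ := exists_eq_var t₁
      obtain ⟨j, rfl⟩ := exists_eq_var t₂
      refine (D0.eq (f i) (f j)).congr fun w => ?_
      rw [BoundedFormula.realize_bdEqual, Term.realize_var, Term.realize_var]
      cases i <;> cases j <;> rfl
    | rel R ts =>
      cases R with
      | mem =>
        obtain ⟨i, hi⟩ := exists_eq_var (ts 0)
        obtain ⟨j, hj⟩ := exists_eq_var (ts 1)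
        refine (D0.mem (f i) (f j)).congr fun w => ?_
        refine Iff.trans ?_ (BoundedFormula.realize_rel.trans (relMap_mem _)).symm
        rw [hi, hj, Term.realize_var, Term.realize_var]
        cases i <;> cases j <;> rfl
  | falsum => exact D0.falsum.congr fun w => BoundedFormula.realize_bot.symm
  | imp _ _ ih₁ ih₂ =>
    exact ((ih₁ f @key).imp (ih₂ f @key)).congr fun w => BoundedFormula.realize_imp.symm
  | @ball n y φ _ ih =>
    refine (D0.ball_scons (f y) (ih (Sum.elim (fun a => some (f (.inl a))) fun i =>
      (i.lastCases none fun i => some (f (.inr i)))) ?_)).congr fun w => ?_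
    · intro n f w i
      cases i <;> rfl
    · rw [BoundedFormula.realize_all]
      refine forall_congr' fun x => ?_
      rw [BoundedFormula.realize_imp, realize_guard, key, key']
      rfl
  | @bex n y φ _ ih =>
    refine (D0.bex (f y) (R := fun v x => φ.Realize (fun a => v (f (.inl a)))
      (Fin.snoc (fun i => v (f (.inr i))) x)) ?_).congr fun w => ?_
    · refine (ih (Sum.elim (fun a => some (f (.inl a))) fun i =>
        (i.lastCases none fun i => some (f (.inr i)))) ?_).congr fun w => ?_
      · intro n f w i
        cases i <;> rfl
      · refine iff_of_eq (congrArg _ ?_)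
        funext i
        refine Fin.lastCases ?_ (fun i => ?_) i <;> simp
    · rw [BoundedFormula.realize_ex]
      refine exists_congr fun x => ?_
      rw [BoundedFormula.realize_inf, realize_guard, key]

/-- The other side of the Lévy hierarchy. -/
def Side.dual : Side → Side
  | .sigma => .pi
  | .pi => .sigma

/-- The relations on a structure that are defined by the formulas of a class of the Lévy
hierarchy. -/
inductive Lev : Side → ℕ → ∀ {ι : Type}, ((ι → M) → Prop) → Prop
  | delta0 (s : Side) {ι : Type} {P : (ι → M) → Prop} : D0 P → Lev s 0 P
  | sigma_of_pi {k : ℕ} {ι : Type} {P : (ι → M) → Prop} : Lev .pi k P → Lev .sigma (k + 1) P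
  | pi_of_sigma {k : ℕ} {ι : Type} {P : (ι → M) → Prop} : Lev .sigma k P → Lev .pi (k + 1) P
  | ex_scons {k : ℕ} {ι : Type} {P : (Option ι → M) → Prop} :
      Lev .sigma (k + 1) P → Lev .sigma (k + 1) fun v : ι → M => ∃ x, P (scons x v)
  | all_scons {k : ℕ} {ι : Type} {P : (Option ι → M) → Prop} :
      Lev .pi (k + 1) P → Lev .pi (k + 1) fun v : ι → M => ∀ x, P (scons x v)

namespace Lev

variable {s : Side} {k : ℕ} {P Q : (ι → M) → Prop}

theorem congr (h : Lev s k P) (hPQ : ∀ v, P v ↔ Q v) : Lev s k Q := by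
  rwa [← show P = Q from funext fun v => propext (hPQ v)]

theorem all {R : (ι → M) → M → Prop}
    (h : Lev .pi (k + 1) fun w : Option ι → M => R (fun i => w (some i)) (w none)) :
    Lev .pi (k + 1) fun v => ∀ x, R v x :=
  .all_scons h

theorem relabel (h : Lev s k P) (f : ι → κ) : Lev s k fun v : κ → M => P fun i => v (f i) := by
  induction h generalizing κ with
  | delta0 s h => exact .delta0 s (h.relabel f)
  | sigma_of_pi _ ih => exact .sigma_of_pi (ih f)
  | pi_of_sigma _ ih => exact .pi_of_sigma (ih f)
  | ex_scons _ ih =>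
    refine (ex_scons (ih (Option.map f))).congr fun v => ?_
    exact exists_congr fun x => iff_of_eq (congrArg _ (scons_comp_map x v f))
  | all_scons _ ih =>
    refine (all_scons (ih (Option.map f))).congr fun v => ?_
    exact forall_congr' fun x => iff_of_eq (congrArg _ (scons_comp_map x v f))

theorem not (h : Lev s k P) : Lev s.dual k fun v => ¬ P v := by
  induction h with
  | delta0 s h => exact .delta0 _ h.not
  | sigma_of_pi _ ih => exact .pi_of_sigma ih
  | pi_of_sigma _ ih => exact .sigma_of_pi ih
  | ex_scons _ ih => exact (all_scons ih).congr fun v => not_exists.symm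
  | all_scons _ ih => exact (ex_scons ih).congr fun v => not_forall.symm

theorem succ (h : Lev s k P) : Lev s (k + 1) P := by
  induction h with
  | delta0 s h =>
    cases s
    exacts [.sigma_of_pi (.delta0 _ h), .pi_of_sigma (.delta0 _ h)]
  | sigma_of_pi _ ih => exact .sigma_of_pi ih
  | pi_of_sigma _ ih => exact .pi_of_sigma ih
  | ex_scons _ ih => exact .ex_scons ih
  | all_scons _ ih => exact .all_scons ih

theorem mono {l : ℕ} (h : Lev s k P) (hkl : k ≤ l) : Lev s l P := by
  induction hkl with
  | refl => exact h
  | step _ ih => exact ih.succ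

theorem of_d0 (h : D0 P) (s : Side) (k : ℕ) : Lev s k P :=
  (Lev.delta0 s h).mono (Nat.zero_le k)

/-- One half of bringing a disjunction to prenex form: the existential block of `Q` is pulled out,
given that disjunctions of `P` with Π_k relations are already settled. The renaming `f` carries `P`
into contexts enlarged by the quantified variables. -/
theorem or_of_pi [Nonempty M]
    (hP : ∀ {κ : Type} (f : ι → κ) {Q : (κ → M) → Prop}, Lev .pi k Q →
      Lev .pi k fun v => (P fun i => v (f i)) ∨ Q v)
    {κ : Type} (f : ι → κ) {Q : (κ → M) → Prop} (hQ : Lev .sigma (k + 1) Q) :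
    Lev .sigma (k + 1) fun v => (P fun i => v (f i)) ∨ Q v := by
  generalize hs : Side.sigma = s, hl : k + 1 = l at hQ
  induction hQ with
  | delta0 => cases hl
  | sigma_of_pi hQ =>
    obtain rfl : k = _ := Nat.succ.inj hl
    exact .sigma_of_pi (hP f hQ)
  | pi_of_sigma => cases hs
  | ex_scons _ ih =>
    exact (ex_scons (ih (fun i => some (f i)) hs hl)).congr fun v => by
      simp only [scons_some]
      exact exists_or.trans (or_congr (exists_const M) Iff.rfl)
  | all_scons => cases hs

theorem or_of_sigma [Nonempty M]
    (hP : ∀ {κ : Type} (f : ι → κ) {Q : (κ → M) → Prop}, Lev .sigma k Q →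
      Lev .sigma k fun v => (P fun i => v (f i)) ∨ Q v)
    {κ : Type} (f : ι → κ) {Q : (κ → M) → Prop} (hQ : Lev .pi (k + 1) Q) :
    Lev .pi (k + 1) fun v => (P fun i => v (f i)) ∨ Q v := by
  generalize hs : Side.pi = s, hl : k + 1 = l at hQ
  induction hQ with
  | delta0 => cases hl
  | sigma_of_pi => cases hs
  | pi_of_sigma hQ =>
    obtain rfl : k = _ := Nat.succ.inj hl
    exact .pi_of_sigma (hP f hQ)
  | ex_scons => cases hs
  | all_scons _ ih =>
    exact (all_scons (ih (fun i => some (f i)) hs hl)).congr fun v => by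
      simp only [scons_some]
      exact forall_or_left

/-- The outer block of `P` is pulled out first, then that of `Q`, and the level drops by one.
Nonemptiness allows a vacuous existential quantifier over the other disjunct. -/
theorem or_relabel [Nonempty M] (hP : Lev s k P) {κ : Type} (f : ι → κ) {Q : (κ → M) → Prop}
    (hQ : Lev s k Q) : Lev s k fun v => (P fun i => v (f i)) ∨ Q v := by
  induction hP generalizing κ with
  | delta0 s h =>
    cases hQ with
    | delta0 _ hQ => exact .delta0 _ ((h.relabel f).or hQ)
  | sigma_of_pi _ ih => exact or_of_pi ih f hQ
  | pi_of_sigma _ ih => exact or_of_sigma ih f hQ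
  | ex_scons _ ih =>
    refine (ex_scons (ih (Option.map f) (hQ.relabel some))).congr fun v => ?_
    simp only [scons_some]
    refine exists_or.trans (or_congr (exists_congr fun x => ?_) (exists_const M))
    exact iff_of_eq (congrArg _ (scons_comp_map x v f))
  | all_scons _ ih =>
    refine (all_scons (ih (Option.map f) (hQ.relabel some))).congr fun v => ?_
    simp only [scons_some]
    refine Iff.trans (forall_congr' fun x => or_congr ?_ Iff.rfl) forall_or_right
    exact iff_of_eq (congrArg _ (scons_comp_map x v f))

theorem or [Nonempty M] (hP : Lev s k P) (hQ : Lev s k Q) : Lev s k fun v => P v ∨ Q v :=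
  hP.or_relabel id hQ

theorem and [Nonempty M] (hP : Lev s k P) (hQ : Lev s k Q) : Lev s k fun v => P v ∧ Q v := by
  have := (hP.not.or hQ.not).not
  rw [show s.dual.dual = s by cases s <;> rfl] at this
  exact this.congr fun v => by tauto

theorem exists_formula (h : Lev s k P) {α : Type} {n : ℕ} (f : ι → α ⊕ Fin n) :
    ∃ φ : Lset.BoundedFormula α n, IsLevy s k φ ∧
      ∀ (v : α → M) xs, φ.Realize v xs ↔ P fun i => Sum.elim v xs (f i) := by
  have key {ι : Type} {n : ℕ} (f : ι → α ⊕ Fin n) (v : α → M) (xs : Fin n → M) (x : M) :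
      (fun o : Option ι => Sum.elim v (Fin.snoc xs x : Fin (n + 1) → M) (o.elim
        (.inr (Fin.last n)) fun i => Sum.map id Fin.castSucc (f i))) =
        scons x fun i => Sum.elim v xs (f i) := by
    funext o
    cases o with
    | none => simp
    | some i => cases h : f i <;> simp [h]
  induction h generalizing n with
  | delta0 s h =>
    obtain ⟨φ, hφ, hφ'⟩ := h.exists_formula f
    exact ⟨φ, .delta0 s hφ, hφ'⟩
  | sigma_of_pi _ ih =>
    obtain ⟨φ, hφ, hφ'⟩ := ih f
    exact ⟨φ, .sigma_of_pi hφ, hφ'⟩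
  | pi_of_sigma _ ih =>
    obtain ⟨φ, hφ, hφ'⟩ := ih f
    exact ⟨φ, .pi_of_sigma hφ, hφ'⟩
  | ex_scons _ ih =>
    obtain ⟨φ, hφ, hφ'⟩ := ih fun o =>
      o.elim (.inr (Fin.last n)) fun i => Sum.map id Fin.castSucc (f i)
    refine ⟨_, .ex hφ, fun v xs => BoundedFormula.realize_ex.trans (exists_congr fun x => ?_)⟩
    rw [hφ', key]
  | all_scons _ ih =>
    obtain ⟨φ, hφ, hφ'⟩ := ih fun o =>
      o.elim (.inr (Fin.last n)) fun i => Sum.map id Fin.castSucc (f i)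
    refine ⟨_, .all hφ, fun v xs => BoundedFormula.realize_all.trans (forall_congr' fun x => ?_)⟩
    rw [hφ', key]

end Lev

theorem IsLevy.lev {s : Side} {k : ℕ} {α : Type} {n : ℕ} {φ : Lset.BoundedFormula α n}
    (h : IsLevy s k φ) (f : α ⊕ Fin n → ι) :
    Lev s k fun w : ι → M => φ.Realize (fun a => w (f (.inl a))) fun i => w (f (.inr i)) := by
  have key {ι : Type} {n : ℕ} (f : α ⊕ Fin n → ι) (w : ι → M) (x : M) :
      (fun i : Fin (n + 1) => scons x w ((Sum.elim (fun a => some (f (.inl a))) fun i =>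
        (i.lastCases none fun i => some (f (.inr i))) : α ⊕ Fin (n + 1) → Option ι) (.inr i))) =
        Fin.snoc (fun i => w (f (.inr i))) x := by
    funext i
    refine Fin.lastCases ?_ (fun i => ?_) i <;> simp
  induction h generalizing ι with
  | delta0 s h => exact .delta0 s (h.d0 f)
  | sigma_of_pi _ ih => exact .sigma_of_pi (ih f)
  | pi_of_sigma _ ih => exact .pi_of_sigma (ih f)
  | ex _ ih =>
    refine (Lev.ex_scons (ih (Sum.elim (fun a => some (f (.inl a))) fun i =>
      (i.lastCases none fun i => some (f (.inr i)))))).congr fun w => ?_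
    rw [BoundedFormula.realize_ex]
    exact exists_congr fun x => iff_of_eq (congrArg _ (key f w x))
  | all _ ih =>
    refine (Lev.all_scons (ih (Sum.elim (fun a => some (f (.inl a))) fun i =>
      (i.lastCases none fun i => some (f (.inr i)))))).congr fun w => ?_
    rw [BoundedFormula.realize_all]
    exact forall_congr' fun x => iff_of_eq (congrArg _ (key f w x))

end Semantic

end WeakSetTheory

namespace WeakSetTheory

/-! ### The axioms as statements about a structure. -/

section Axioms

variable {M : Type}

theorem comp_vec1 {n : ℕ} (f : Fin n → M) (i : Fin n) : f ∘ ![i] = ![f i] := by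
  funext k
  fin_cases k
  rfl

theorem comp_vec2 {n : ℕ} (f : Fin n → M) (i j : Fin n) : f ∘ ![i, j] = ![f i, f j] := by
  funext k
  fin_cases k <;> rfl

variable [Lset.Structure M]

local infix:50 " ε " => Mem

theorem realize_closure {p : ℕ} (φ : Lset.Formula (Fin p)) :
    M ⊨ closure φ ↔ ∀ c : Fin p → M, φ.Realize c := by
  rw [closure, Sentence.Realize, BoundedFormula.realize_alls]
  refine forall_congr' fun c => ?_
  rw [BoundedFormula.realize_relabel, Formula.Realize]
  exact iff_of_eq (congrArg₂ _ rfl (Subsingleton.elim _ _))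

theorem realize_plug {p k n : ℕ} (φ : Lset.Formula (Fin p ⊕ Fin k)) (v : Fin k → Fin n)
    (c : Fin p → M) (xs : Fin n → M) :
    (plug φ v).Realize c xs ↔ φ.Realize (Sum.elim c (xs ∘ v)) := by
  rw [plug, BoundedFormula.realize_relabel, Formula.Realize]
  refine iff_of_eq (congrArg₂ _ ?_ (Subsingleton.elim _ _))
  funext i
  cases i <;> rfl

variable (M)

/-- A structure satisfies `Π_k`-collection. -/
def HasCollection (k : ℕ) : Prop :=
  ∀ (p : ℕ) (φ : Lset.Formula (Fin p ⊕ Fin 2)), IsPi k φ → ∀ (c : Fin p → M) (w : M),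
    (∀ x, x ε w → ∃ y, φ.Realize (Sum.elim c ![x, y])) →
      ∃ C, ∀ x, x ε w → ∃ y, y ε C ∧ φ.Realize (Sum.elim c ![x, y])

/-- A structure satisfies strong `Π_k`-collection. -/
def HasStrongCollection (k : ℕ) : Prop :=
  ∀ (p : ℕ) (φ : Lset.Formula (Fin p ⊕ Fin 2)), IsPi k φ → ∀ (c : Fin p → M) (w : M),
    ∃ C, ∀ x, x ε w → (∃ y, φ.Realize (Sum.elim c ![x, y])) →
      ∃ y, y ε C ∧ φ.Realize (Sum.elim c ![x, y])

/-- A structure satisfies the axiom of choice. -/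
def HasChoice : Prop :=
  ∀ x : M, ((∀ u, u ε x → ∃ y, y ε u) ∧
    ∀ u v, u ε x ∧ v ε x → (∃ y, y ε u ∧ y ε v) → u = v) →
      ∃ c, ∀ u, u ε x → ∃ y, (y ε c ∧ y ε u) ∧ ∀ z, z ε c ∧ z ε u → z = y

/-- A structure satisfies the axioms of the theory `M`. -/
structure IsModelM : Prop where
  ext (x y : M) : (∀ z, z ε x ↔ z ε y) → x = y
  empty : ∃ x : M, ∀ y, ¬ y ε x
  pair (x y : M) : ∃ z, ∀ u, u ε z ↔ u = x ∨ u = y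
  union (x : M) : ∃ y, ∀ z, z ε y ↔ ∃ u, u ε x ∧ z ε u
  diff (x y : M) : ∃ z, ∀ u, u ε z ↔ u ε x ∧ ¬ u ε y
  pow (x : M) : ∃ y, ∀ z, z ε y ↔ ∀ u, u ε z → u ε x
  trans (x : M) : ∃ y, (∀ u, u ε y → ∀ v, v ε u → v ε y) ∧ ∀ u, u ε x → u ε y
  inf : ∃ x : M, (∃ y, y ε x ∧ ∀ u, ¬ u ε y) ∧
    ∀ y, y ε x → ∃ z, z ε x ∧ ∀ u, u ε z ↔ u ε y ∨ u = y
  found (z : M) : (∃ x, x ε z) → ∃ y, y ε z ∧ ∀ x, x ε y → ¬ x ε z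
  sep (p : ℕ) (φ : Lset.Formula (Fin p ⊕ Fin 1)) (hφ : IsDelta0 φ) (c : Fin p → M) (w : M) :
    ∃ y, ∀ x, x ε y ↔ x ε w ∧ φ.Realize (Sum.elim c ![x])

variable {M}

theorem model_piCollection_iff {k : ℕ} : M ⊨ piCollection k ↔ HasCollection M k := by
  have key (p : ℕ) (φ : Lset.Formula (Fin p ⊕ Fin 2)) : M ⊨ closure (collectionInstance φ) ↔
      ∀ (c : Fin p → M) (w : M), (∀ x, x ε w → ∃ y, φ.Realize (Sum.elim c ![x, y])) →
        ∃ C, ∀ x, x ε w → ∃ y, y ε C ∧ φ.Realize (Sum.elim c ![x, y]) := by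
    rw [realize_closure]
    refine forall_congr' fun c => ?_
    simp [collectionInstance, Formula.Realize, realize_plug, comp_vec2, Fin.snoc]
  rw [Theory.model_iff]
  constructor
  · exact fun h p φ hφ => (key p φ).1 (h _ ⟨p, φ, hφ, rfl⟩)
  · rintro h _ ⟨p, φ, hφ, rfl⟩
    exact (key p φ).2 (h p φ hφ)

theorem model_strongPiCollection_iff {k : ℕ} :
    M ⊨ strongPiCollection k ↔ HasStrongCollection M k := by
  have key (p : ℕ) (φ : Lset.Formula (Fin p ⊕ Fin 2)) :
      M ⊨ closure (strongCollectionInstance φ) ↔ ∀ (c : Fin p → M) (w : M),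
        ∃ C, ∀ x, x ε w → (∃ y, φ.Realize (Sum.elim c ![x, y])) →
          ∃ y, y ε C ∧ φ.Realize (Sum.elim c ![x, y]) := by
    rw [realize_closure]
    refine forall_congr' fun c => ?_
    simp [strongCollectionInstance, Formula.Realize, realize_plug, comp_vec2, Fin.snoc]
  rw [Theory.model_iff]
  constructor
  · exact fun h p φ hφ => (key p φ).1 (h _ ⟨p, φ, hφ, rfl⟩)
  · rintro h _ ⟨p, φ, hφ, rfl⟩
    exact (key p φ).2 (h p φ hφ)

theorem model_delta0Separation_iff : M ⊨ delta0Separation ↔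
    ∀ (p : ℕ) (φ : Lset.Formula (Fin p ⊕ Fin 1)), IsDelta0 φ → ∀ (c : Fin p → M) (w : M),
      ∃ y, ∀ x, x ε y ↔ x ε w ∧ φ.Realize (Sum.elim c ![x]) := by
  have key (p : ℕ) (φ : Lset.Formula (Fin p ⊕ Fin 1)) :
      M ⊨ closure (separationInstance φ) ↔ ∀ (c : Fin p → M) (w : M),
        ∃ y, ∀ x, x ε y ↔ x ε w ∧ φ.Realize (Sum.elim c ![x]) := by
    rw [realize_closure]
    refine forall_congr' fun c => ?_
    simp [separationInstance, Formula.Realize, realize_plug, comp_vec1, Fin.snoc]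
  rw [Theory.model_iff]
  constructor
  · exact fun h p φ hφ => (key p φ).1 (h _ ⟨p, φ, hφ, rfl⟩)
  · rintro h _ ⟨p, φ, hφ, rfl⟩
    exact (key p φ).2 (h p φ hφ)

theorem model_choice_iff : M ⊨ choice ↔ HasChoice M := by
  simp [choice, HasChoice, Sentence.Realize, Formula.Realize, Fin.snoc]

theorem model_theoryM_iff : M ⊨ theoryM ↔ IsModelM M := by
  have h₁ : M ⊨ extensionality ↔ ∀ x y : M, (∀ z, z ε x ↔ z ε y) → x = y := by
    simp [extensionality, Sentence.Realize, Formula.Realize, Fin.snoc]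
  have h₂ : M ⊨ emptySet ↔ ∃ x : M, ∀ y, ¬ y ε x := by
    simp [emptySet, Sentence.Realize, Formula.Realize, Fin.snoc]
  have h₃ : M ⊨ pairing ↔ ∀ x y : M, ∃ z, ∀ u, u ε z ↔ u = x ∨ u = y := by
    simp [pairing, Sentence.Realize, Formula.Realize, Fin.snoc]
  have h₄ : M ⊨ union ↔ ∀ x : M, ∃ y, ∀ z, z ε y ↔ ∃ u, u ε x ∧ z ε u := by
    simp [union, Sentence.Realize, Formula.Realize, Fin.snoc]
  have h₅ : M ⊨ setDifference ↔ ∀ x y : M, ∃ z, ∀ u, u ε z ↔ u ε x ∧ ¬ u ε y := by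
    simp [setDifference, Sentence.Realize, Formula.Realize, Fin.snoc]
  have h₆ : M ⊨ powerset ↔ ∀ x : M, ∃ y, ∀ z, z ε y ↔ ∀ u, u ε z → u ε x := by
    simp [powerset, Sentence.Realize, Formula.Realize, Fin.snoc]
  have h₇ : M ⊨ transitiveContainment ↔ ∀ x : M, ∃ y, (∀ u, u ε y → ∀ v, v ε u → v ε y) ∧
      ∀ u, u ε x → u ε y := by
    simp [transitiveContainment, Sentence.Realize, Formula.Realize, Fin.snoc]
  have h₈ : M ⊨ infinity ↔ ∃ x : M, (∃ y, y ε x ∧ ∀ u, ¬ u ε y) ∧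
      ∀ y, y ε x → ∃ z, z ε x ∧ ∀ u, u ε z ↔ u ε y ∨ u = y := by
    simp [infinity, Sentence.Realize, Formula.Realize, Fin.snoc]
  have h₉ : M ⊨ setFoundation ↔ ∀ z : M, (∃ x, x ε z) → ∃ y, y ε z ∧ ∀ x, x ε y → ¬ x ε z := by
    simp [setFoundation, Sentence.Realize, Formula.Realize, Fin.snoc]
  rw [theoryM, S1, Theory.model_union_iff, Theory.model_union_iff, model_delta0Separation_iff]
  simp only [Theory.model_insert_iff, Theory.model_singleton_iff, h₁, h₂, h₃, h₄, h₅, h₆, h₇, h₈,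
    h₉]
  constructor
  · rintro ⟨⟨⟨a₁, a₂, a₃, a₄, a₅, a₆⟩, a₇, a₈, a₉⟩, a⟩
    exact ⟨a₁, a₂, a₃, a₄, a₅, a₆, a₇, a₈, a₉, a⟩
  · rintro ⟨a₁, a₂, a₃, a₄, a₅, a₆, a₇, a₈, a₉, a⟩
    exact ⟨⟨⟨a₁, a₂, a₃, a₄, a₅, a₆⟩, a₇, a₈, a₉⟩, a⟩

end Axioms

end WeakSetTheory

namespace WeakSetTheory

/-! ### Coding finite tuples by iterated Kuratowski pairs. -/

section Tuples

variable {M : Type} [Lset.Structure M] {ι κ : Type}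

local infix:50 " ε " => Mem

/-- `s = {x, y}` -/
def IsUPair (s x y : M) : Prop :=
  x ε s ∧ y ε s ∧ ∀ u, u ε s → u = x ∨ u = y

/-- `z` is the Kuratowski pair of `x` and `y`. -/
def IsPair (z x y : M) : Prop :=
  (∃ s, s ε z ∧ IsUPair s x x) ∧ (∃ s, s ε z ∧ IsUPair s x y) ∧
    ∀ s, s ε z → IsUPair s x x ∨ IsUPair s x y

theorem IsPair.inj {z x y x' y' : M} (h : IsPair z x y) (h' : IsPair z x' y') :
    x = x' ∧ y = y' := by
  simp only [IsPair, IsUPair] at h h'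
  grind

/-- `z` is the iterated pair `⟨u 0, ⟨u 1, …⟩⟩`. -/
def IsTuple : ∀ n : ℕ, M → (Fin n → M) → Prop
  | 0, _, _ => True
  | n + 1, z, u => ∃ t, IsPair z (u 0) t ∧ IsTuple n t fun i => u i.succ

theorem IsTuple.inj : ∀ {n : ℕ} {z : M} {u u' : Fin n → M}, IsTuple n z u → IsTuple n z u' → u = u'
  | 0, _, _, _, _, _ => Subsingleton.elim _ _
  | n + 1, z, u, u', ⟨t, h₁, h₂⟩, ⟨t', h₁', h₂'⟩ => by
    obtain ⟨h₀, rfl⟩ := h₁.inj h₁'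
    funext i
    exact i.cases h₀ fun i => congrFun (h₂.inj h₂') i

namespace D0

theorem isUPair (a b c : ι) : D0 fun v : ι → M => IsUPair (v a) (v b) (v c) :=
  (D0.mem b a).and ((D0.mem c a).and (ball a ((D0.eq _ _).or (D0.eq _ _))))

theorem isPair (a b c : ι) : D0 fun v : ι → M => IsPair (v a) (v b) (v c) :=
  (bex a (isUPair none (some b) (some b))).and ((bex a (isUPair none (some b) (some c))).and
    (ball a ((isUPair none (some b) (some b)).or (isUPair none (some b) (some c)))))

/-- The second component of a pair is a member of a member of it, so the quantifier over the tail of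
the tuple can be bounded. -/
theorem isTuple (n : ℕ) {ι : Type} (a : ι) (f : Fin n → ι) :
    D0 fun v : ι → M => IsTuple n (v a) fun i => v (f i) := by
  induction n generalizing ι with
  | zero => exact (falsum.not).congr fun v => ⟨fun _ => trivial, fun _ => id⟩
  | succ n ih =>
    refine congr (P := fun v => ∃ s, s ε v a ∧ ∃ t, t ε s ∧ IsPair (v a) (v (f 0)) t ∧
      IsTuple n t fun i => v (f i.succ)) (bex a (bex none
        ((isPair (some (some a)) (some (some (f 0))) none).and
          (ih none fun i => some (some (f i.succ)))))) fun v => ?_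
    constructor
    · rintro ⟨s, -, t, -, h⟩
      exact ⟨t, h⟩
    · rintro ⟨t, h₁, h₂⟩
      obtain ⟨s, hs, h⟩ := h₁.2.1
      exact ⟨s, hs, t, h.2.1, h₁, h₂⟩

theorem exists_isTuple (n : ℕ) {ι : Type} (a : ι) :
    D0 fun v : ι → M => ∃ u : Fin n → M, IsTuple n (v a) u := by
  induction n generalizing ι with
  | zero => exact (falsum.not).congr fun v => ⟨fun _ => ⟨Fin.elim0, trivial⟩, fun _ => id⟩
  | succ n ih =>
    refine congr (P := fun v => ∃ s, s ε v a ∧ ∃ x, x ε s ∧ ∃ t, t ε s ∧ IsPair (v a) x t ∧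
      ∃ u, IsTuple n t u) (bex a (bex none (bex (some none)
        ((isPair (some (some (some a))) (some none) none).and (ih none))))) fun v => ?_
    constructor
    · rintro ⟨s, -, x, -, t, -, h, u, hu⟩
      exact ⟨Fin.cons x u, t, h, hu⟩
    · rintro ⟨u, t, h, hu⟩
      obtain ⟨s, hs, h'⟩ := h.2.1
      exact ⟨s, hs, u 0, h'.1, t, h'.2.1, h, _, hu⟩

end D0

namespace Lev

variable {s : Side} {k : ℕ}

theorem imp_of_d0 [Nonempty M] {P Q : (ι → M) → Prop} (hP : D0 P) (hQ : Lev s k Q) :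
    Lev s k fun v => P v → Q v :=
  ((of_d0 hP.not s k).or hQ).congr fun v => by tauto

theorem forall_fin {n : ℕ} {ι : Type} {R : (ι → M) → (Fin n → M) → Prop}
    (h : Lev .pi (k + 1) fun w : ι ⊕ Fin n → M => R (fun i => w (.inl i)) fun j => w (.inr j)) :
    Lev .pi (k + 1) fun v => ∀ u, R v u := by
  induction n generalizing ι with
  | zero =>
    refine (h.relabel (Sum.elim id Fin.elim0)).congr fun v => ?_
    rw [Unique.forall_iff]
    exact iff_of_eq (congrArg _ (Subsingleton.elim _ _))
  | succ n ih =>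
    refine (all (R := fun v x => ∀ u : Fin n → M, R v (Fin.cons x u)) (ih ?_)).congr fun v =>
      (Fin.forall_fin_succ_pi (P := R v)).symm
    refine (h.relabel (Sum.elim (fun i => .inl (some i)) (Fin.cases (.inl none) .inr))).congr
      fun v => iff_of_eq (congrArg _ ?_)
    funext j
    exact j.cases rfl fun _ => rfl

/-- Separates the whole existential block from its Π_k matrix, so that the block can later be coded
as one tuple. -/
theorem exists_pi {P : (ι → M) → Prop} (h : Lev .sigma (k + 1) P) :
    ∃ (n : ℕ) (Q : (ι ⊕ Fin n → M) → Prop), Lev .pi k Q ∧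
      ∀ v, P v ↔ ∃ u : Fin n → M, Q (Sum.elim v u) := by
  generalize hs : Side.sigma = s, hl : k + 1 = l at h
  induction h with
  | delta0 => cases hl
  | sigma_of_pi h =>
    obtain rfl : k = _ := Nat.succ.inj hl
    exact ⟨0, _, h.relabel (Sum.inl : _ → _ ⊕ Fin 0), fun v => ⟨fun h => ⟨Fin.elim0, h⟩, fun ⟨_, h⟩ => h⟩⟩
  | pi_of_sigma => cases hs
  | ex_scons _ ih =>
    obtain ⟨n, Q, hQ, h⟩ := ih hs hl
    refine ⟨n + 1, _, hQ.relabel (Sum.elim (fun o => o.elim (.inr 0) .inl) fun j => .inr j.succ),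
      fun v => ?_⟩
    rw [Fin.exists_fin_succ_pi]
    refine exists_congr fun x => (h _).trans (exists_congr fun u => iff_of_eq (congrArg _ ?_))
    funext i
    rcases i with (_ | i) | j <;> rfl
  | all_scons => cases hs

end Lev

/-- The second clause places the pair in the double power set of any set that contains `x` and `y`.
-/
theorem IsModelM.exists_isPair (hM : IsModelM M) (x y : M) :
    ∃ z, IsPair z x y ∧ ∀ s, s ε z → ∀ u, u ε s → u = x ∨ u = y := by
  obtain ⟨a, ha⟩ := hM.pair x x
  obtain ⟨b, hb⟩ := hM.pair x y
  obtain ⟨z, hz⟩ := hM.pair a b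
  refine ⟨z, ?_, ?_⟩
  · have h₁ : IsUPair a x x := ⟨(ha x).2 (.inl rfl), (ha x).2 (.inl rfl), fun u => (ha u).1⟩
    have h₂ : IsUPair b x y := ⟨(hb x).2 (.inl rfl), (hb y).2 (.inr rfl), fun u => (hb u).1⟩
    refine ⟨⟨a, (hz a).2 (.inl rfl), h₁⟩, ⟨b, (hz b).2 (.inr rfl), h₂⟩, fun s hs => ?_⟩
    rcases (hz s).1 hs with rfl | rfl
    exacts [.inl h₁, .inr h₂]
  · grind

theorem IsModelM.exists_isTuple (hM : IsModelM M) : ∀ (n : ℕ) (u : Fin n → M), ∃ z, IsTuple n z u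
  | 0, _ => hM.empty.imp fun _ _ => trivial
  | n + 1, u => by
    obtain ⟨t, ht⟩ := hM.exists_isTuple n fun i => u i.succ
    obtain ⟨z, hz, -⟩ := hM.exists_isPair (u 0) t
    exact ⟨z, t, hz, ht⟩

theorem IsModelM.exists_union (hM : IsModelM M) (x y : M) :
    ∃ z : M, ∀ u, u ε z ↔ u ε x ∨ u ε y := by
  obtain ⟨a, ha⟩ := hM.pair x y
  obtain ⟨z, hz⟩ := hM.union a
  exact ⟨z, fun u => by grind⟩

/-- A superset of the n-th power of `B` suffices, so iterated double power sets do and nothing has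
to be separated out. -/
theorem IsModelM.exists_tuples (hM : IsModelM M) (n : ℕ) (B : M) :
    ∃ W, ∀ u : Fin n → M, (∀ i, u i ε B) → ∃ z, z ε W ∧ IsTuple n z u := by
  induction n with
  | zero =>
    obtain ⟨e, -⟩ := hM.empty
    obtain ⟨W, hW⟩ := hM.pair e e
    exact ⟨W, fun u _ => ⟨e, (hW e).2 (.inl rfl), trivial⟩⟩
  | succ n ih =>
    obtain ⟨T, hT⟩ := ih
    obtain ⟨Q, hQ⟩ := hM.exists_union B T
    obtain ⟨Q₁, hQ₁⟩ := hM.pow Q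
    obtain ⟨Q₂, hQ₂⟩ := hM.pow Q₁
    refine ⟨Q₂, fun u hu => ?_⟩
    obtain ⟨t, ht, htu⟩ := hT (fun i => u i.succ) fun i => hu _
    obtain ⟨z, hz, hz'⟩ := hM.exists_isPair (u 0) t
    refine ⟨z, (hQ₂ z).2 fun s hs => (hQ₁ s).2 fun x hx => (hQ x).2 ?_, t, hz, htu⟩
    rcases hz' s hs x hx with rfl | rfl
    exacts [.inl (hu 0), .inr ht]

end Tuples

/-! ### Bounding quantifiers by strong collection. -/

section Reflection

variable {M : Type} [Lset.Structure M] {ι κ : Type}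

local infix:50 " ε " => Mem

theorem IsModelM.exists_sep (hM : IsModelM M) [Finite ι] {R : (ι → M) → M → Prop}
    (hR : D0 fun w : Option ι → M => R (fun i => w (some i)) (w none)) (v : ι → M) (w : M) :
    ∃ y, ∀ x, x ε y ↔ x ε w ∧ R v x := by
  obtain ⟨n, ⟨e⟩⟩ := Finite.exists_equiv_fin ι
  obtain ⟨φ, hφ, hφ'⟩ := hR.exists_formula (α := Fin n ⊕ Fin 1) (n := 0)
    fun o => .inl (o.elim (.inr 0) fun i => .inl (e i))
  obtain ⟨y, hy⟩ := hM.sep n φ hφ (v ∘ e.symm) w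
  refine ⟨y, fun x => (hy x).trans (and_congr_right fun _ => (hφ' _ _).trans ?_)⟩
  simp

theorem lev_iff_exists_formula₂ [Finite ι] {s : Side} {k : ℕ} {R : (ι → M) → M → M → Prop}
    (hR : Lev s k fun w : Option (Option ι) → M =>
      R (fun i => w (some (some i))) (w (some none)) (w none)) (v : ι → M) :
    ∃ (p : ℕ) (φ : Lset.Formula (Fin p ⊕ Fin 2)) (c : Fin p → M), IsLevy s k φ ∧
      ∀ x y, φ.Realize (Sum.elim c ![x, y]) ↔ R v x y := by
  obtain ⟨n, ⟨e⟩⟩ := Finite.exists_equiv_fin ι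
  obtain ⟨φ, hφ, hφ'⟩ := hR.exists_formula (α := Fin n ⊕ Fin 2) (n := 0)
    fun o => .inl (o.elim (.inr 1) fun o => o.elim (.inr 0) fun i => .inl (e i))
  refine ⟨n, φ, v ∘ e.symm, hφ, fun x y => (hφ' _ _).trans ?_⟩
  simp

theorem HasStrongCollection.exists_collecting {k : ℕ} (hM : HasStrongCollection M k) [Finite ι]
    {R : (ι → M) → M → M → Prop} (hR : Lev .pi k fun w : Option (Option ι) → M =>
      R (fun i => w (some (some i))) (w (some none)) (w none)) (v : ι → M) (w : M) :
    ∃ C, ∀ x, x ε w → (∃ y, R v x y) → ∃ y, y ε C ∧ R v x y := by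
  obtain ⟨p, φ, c, hφ, h⟩ := lev_iff_exists_formula₂ hR v
  simpa only [h] using hM p φ hφ c w

theorem HasCollection.exists_collecting {k : ℕ} (hM : HasCollection M k) [Finite ι]
    {R : (ι → M) → M → M → Prop} (hR : Lev .pi k fun w : Option (Option ι) → M =>
      R (fun i => w (some (some i))) (w (some none)) (w none)) (v : ι → M) (w : M)
    (h : ∀ x, x ε w → ∃ y, R v x y) : ∃ C, ∀ x, x ε w → ∃ y, y ε C ∧ R v x y := by
  obtain ⟨p, φ, c, hφ, h'⟩ := lev_iff_exists_formula₂ hR v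
  simp only [← h'] at h ⊢
  exact hM p φ hφ c w h

/-- Collection is applied to φ(x, y) ∨ ∀ z ¬φ(x, z). This is Π_{k+1} and holds of some `y` for every
`x`; where φ(x, ·) has a witness, the second disjunct is impossible. -/
theorem HasCollection.hasStrongCollection [Nonempty M] {k : ℕ} (hM : HasCollection M (k + 1)) :
    HasStrongCollection M k := by
  intro p φ hφ c w
  have hlev : Lev .pi k fun u : Option (Option (Fin p)) → M =>
      φ.Realize (Sum.elim (fun i => u (some (some i))) ![u (some none), u none]) := by
    refine (IsLevy.lev hφ (M := M) (Sum.elim (Sum.elim (fun i => some (some i))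
      ![some none, none]) Fin.elim0)).congr fun u => ?_
    refine iff_of_eq (congrArg₂ _ ?_ (Subsingleton.elim _ _))
    funext i
    rcases i with i | i
    · rfl
    · fin_cases i <;> rfl
  let R : (Fin p → M) → M → M → Prop := fun c x y =>
    φ.Realize (Sum.elim c ![x, y]) ∨ ∀ z, ¬ φ.Realize (Sum.elim c ![x, z])
  have hR : Lev .pi (k + 1) fun u : Option (Option (Fin p)) → M =>
      R (fun i => u (some (some i))) (u (some none)) (u none) := by
    refine Lev.or hlev.succ (Lev.all (R := fun (u : Option (Option (Fin p)) → M) z =>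
      ¬ φ.Realize (Sum.elim (fun i => u (some (some i))) ![u (some none), z])) ?_)
    exact .pi_of_sigma (hlev.not.relabel fun o => o.elim none fun o => some (some o))
  obtain ⟨C, hC⟩ := hM.exists_collecting hR c w fun x _ => by
    by_cases h : ∃ y, φ.Realize (Sum.elim c ![x, y])
    · exact h.imp fun _ => .inl
    · exact ⟨Classical.arbitrary M, .inr (not_exists.1 h)⟩
  refine ⟨C, fun x hx ⟨y, hy⟩ => ?_⟩
  obtain ⟨z, hz, hz'⟩ := hC x hx
  exact ⟨z, hz, hz'.resolve_right fun h => h y hy⟩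

variable {m : ℕ}

/-- Strong collection for `Σ_{m+1}` relations with finitely many variables ranging over a set. -/
theorem IsModelM.exists_collecting (hM : IsModelM M) (hm : 1 ≤ m) (hC : HasStrongCollection M m)
    [Finite ι] {P : (Option ι → M) → Prop} (hP : Lev .sigma (m + 1) P) (B : M) :
    ∃ C, ∀ v : ι → M, (∀ i, v i ε B) → (∃ y, P (scons y v)) → ∃ y, y ε C ∧ P (scons y v) := by
  have : Nonempty M := ⟨B⟩
  obtain ⟨q, ⟨e⟩⟩ := Finite.exists_equiv_fin ι
  obtain ⟨n, Q, hQ, hPQ⟩ := hP.exists_pi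
  obtain ⟨m, rfl⟩ := Nat.exists_eq_add_of_le' hm
  -- Here `x` codes the parameters, and `y` codes the witness followed by the values of the
  -- existential block. Tuples decode uniquely, so decoding by universal quantifiers loses nothing
  -- and keeps the relation Π; these unbounded quantifiers are why `m` must be positive.
  let R : (Empty → M) → M → M → Prop := fun _ x y =>
    (∃ u : Fin (n + 1) → M, IsTuple (n + 1) y u) ∧ ∀ (v : Fin q → M) (u : Fin (n + 1) → M),
      IsTuple q x v → IsTuple (n + 1) y u →
        Q (Sum.elim (scons (u 0) fun i => v (e i)) fun j => u j.succ)
  have hR : Lev .pi (m + 1) fun w : Option (Option Empty) → M =>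
      R (fun i => w (some (some i))) (w (some none)) (w none) := by
    refine (Lev.of_d0 (D0.exists_isTuple (n + 1) none) _ _).and (Lev.forall_fin (Lev.forall_fin ?_))
    refine Lev.imp_of_d0 (D0.isTuple q (Sum.inl (Sum.inl (some none))) fun i => Sum.inl (Sum.inr i))
      (Lev.imp_of_d0 (D0.isTuple (n + 1) (Sum.inl (Sum.inl none)) Sum.inr) ?_)
    refine (hQ.relabel (Sum.elim (fun o => o.elim (Sum.inr 0) fun i => Sum.inl (Sum.inr (e i)))
      fun j => Sum.inr j.succ)).congr fun w => iff_of_eq (congrArg _ ?_)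
    funext i
    rcases i with (_ | i) | j <;> rfl
  obtain ⟨W, hW⟩ := hM.exists_tuples q B
  obtain ⟨C, hC⟩ := hC.exists_collecting hR Empty.elim W
  obtain ⟨C₁, hC₁⟩ := hM.union C
  obtain ⟨C₂, hC₂⟩ := hM.union C₁
  refine ⟨C₂, fun v hv ⟨y, hy⟩ => ?_⟩
  obtain ⟨x, hx, hxv⟩ := hW (v ∘ e.symm) fun i => hv _
  obtain ⟨u, hu⟩ := (hPQ _).1 hy
  obtain ⟨z, hz⟩ := hM.exists_isTuple (n + 1) (Fin.cons y u)
  obtain ⟨z', hz'C, ⟨u', hu'⟩, hz'⟩ := hC x hx ⟨z, ⟨_, hz⟩, fun v' u' hv' hu' => by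
    rw [hv'.inj hxv, hu'.inj hz]
    simpa using hu⟩
  -- The first entry of a tuple in `C` lies in the double union of `C`.
  refine ⟨u' 0, ?_, (hPQ _).2 ⟨fun j => u' j.succ, by simpa using hz' _ _ hxv hu'⟩⟩
  obtain ⟨t, ⟨⟨s, hs, hs'⟩, -⟩, -⟩ := hu'
  exact (hC₂ _).2 ⟨s, (hC₁ _).2 ⟨z', hz'C, hs⟩, hs'.1⟩

/-- On the members of a given set, every relation of the first `m + 1` levels of the Lévy hierarchy
agrees with a `Δ₀` relation with parameters. -/
theorem IsModelM.exists_d0 (hM : IsModelM M) (hm : 1 ≤ m) (hC : HasStrongCollection M m)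
    {s : Side} {k : ℕ} (hk : k ≤ m + 1) [hι : Finite ι] {P : (ι → M) → Prop} (hP : Lev s k P)
    (B : M) :
    ∃ (κ : Type) (_ : Finite κ) (c : κ → M) (Q : (ι ⊕ κ → M) → Prop), D0 Q ∧
      ∀ v : ι → M, (∀ i, v i ε B) → (P v ↔ Q (Sum.elim v c)) := by
  -- A quantifier bounded by `C` costs one new parameter, `C` itself. The matrix is first made Δ₀ on
  -- the union of `B` and `C`, where both the old variables and the new one take their values.
  have bounded {ι : Type} [Finite ι] {P : (Option ι → M) → Prop} (C : M)
      (h : ∀ B, ∃ (κ : Type) (_ : Finite κ) (c : κ → M) (Q : (Option ι ⊕ κ → M) → Prop), D0 Q ∧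
        ∀ v : Option ι → M, (∀ i, v i ε B) → (P v ↔ Q (Sum.elim v c))) (B : M) :
      ∃ (κ : Type) (_ : Finite κ) (c : κ → M) (Q : (ι ⊕ κ → M) → Prop), D0 Q ∧
        ∀ v : ι → M, (∀ i, v i ε B) → ((∃ x, x ε C ∧ P (scons x v)) ↔ Q (Sum.elim v c)) := by
    obtain ⟨A, hA⟩ := hM.exists_union B C
    obtain ⟨κ, _, c, Q, hQ, h⟩ := h A
    refine ⟨Option κ, inferInstance, scons C c, _, D0.bex (.inr none) (R := fun w x =>
      Q (Sum.elim (scons x fun i => w (.inl i)) fun j => w (.inr (some j)))) ?_, fun v hv =>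
        exists_congr fun x => and_congr_right fun hx => h _ ?_⟩
    · refine (hQ.relabel (Sum.elim (fun o => o.elim none fun i => some (.inl i))
        fun j => some (.inr (some j)))).congr fun w => iff_of_eq (congrArg _ ?_)
      funext i
      rcases i with (_ | i) | j <;> rfl
    · rintro (_ | i)
      exacts [(hA x).2 (.inr hx), (hA _).2 (.inl (hv i))]
  revert hι B
  induction hP with
  | delta0 s h =>
    intro _ B
    exact ⟨Empty, inferInstance, Empty.elim, _, h.relabel .inl, fun v _ => Iff.rfl⟩
  | sigma_of_pi _ ih => exact ih (by omega)
  | pi_of_sigma _ ih => exact ih (by omega)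
  | ex_scons hP ih =>
    intro _ B
    obtain ⟨C, hC'⟩ := hM.exists_collecting hm hC (hP.mono hk) B
    obtain ⟨κ, _, c, Q, hQ, h⟩ := bounded C (ih hk) B
    refine ⟨κ, inferInstance, c, Q, hQ, fun v hv => Iff.trans ⟨hC' v hv, ?_⟩ (h v hv)⟩
    exact fun ⟨x, _, hx⟩ => ⟨x, hx⟩
  | all_scons hP ih =>
    intro _ B
    -- Dually, `C` contains a counterexample whenever there is one.
    obtain ⟨C, hC'⟩ := hM.exists_collecting hm hC (hP.not.mono hk) B
    obtain ⟨κ, _, c, Q, hQ, h⟩ := bounded C (fun B => by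
      obtain ⟨κ, _, c, Q, hQ, h⟩ := ih hk B
      exact ⟨κ, inferInstance, c, _, hQ.not, fun v hv => not_congr (h v hv)⟩) B
    refine ⟨κ, inferInstance, c, _, hQ.not, fun v hv => ?_⟩
    rw [← h v hv]
    constructor
    · rintro hP ⟨x, _, hx⟩
      exact hx (hP x)
    · intro hn x
      by_contra hx
      exact hn (hC' v hv ⟨x, hx⟩)

end Reflection

end WeakSetTheory

namespace WeakSetTheory

/-! ### Ultrapowers over the natural numbers. -/

section Ultrapower

variable (M : Type)

/-- The ultrapower of a structure with respect to a nonprincipal ultrafilter on `ℕ`. -/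
noncomputable def Ultrapower : Type :=
  (Filter.hyperfilter ℕ : Filter ℕ).Product fun _ => M

noncomputable instance [Lset.Structure M] : Lset.Structure (Ultrapower M) :=
  Ultraproduct.structure

variable {M}

/-- The element of the ultrapower represented by a sequence. -/
noncomputable def Ultrapower.mk (x : ℕ → M) : Ultrapower M :=
  (x : (Filter.hyperfilter ℕ : Filter ℕ).Product fun _ => M)

theorem Ultrapower.mk_surjective : Function.Surjective (Ultrapower.mk (M := M)) :=
  Quotient.exists_rep

theorem Ultrapower.mk_eq_mk {x y : ℕ → M} :
    mk x = mk y ↔ ∀ᶠ i in Filter.hyperfilter ℕ, x i = y i :=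
  Quotient.eq'

variable [Lset.Structure M]

local infix:50 " ε " => Mem

theorem Ultrapower.realize_mk [Nonempty M] {α : Type} {n : ℕ} (φ : Lset.BoundedFormula α n)
    (v : α → ℕ → M) (xs : Fin n → ℕ → M) :
    φ.Realize (fun a => mk (v a)) (fun i => mk (xs i)) ↔
      ∀ᶠ i in Filter.hyperfilter ℕ, φ.Realize (fun a => v a i) fun k => xs k i :=
  Ultraproduct.boundedFormula_realize_cast φ v xs

theorem Ultrapower.mk_mem_mk {x y : ℕ → M} :
    mk x ε mk y ↔ ∀ᶠ i in Filter.hyperfilter ℕ, x i ε y i := by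
  have : Nonempty M := ⟨x 0⟩
  have h := realize_mk (memF (Term.var (.inl 0)) (Term.var (.inl 1))) ![x, y] Fin.elim0
  simpa using h

theorem eventually_hyperfilter_ge (j : ℕ) : ∀ᶠ i in Filter.hyperfilter ℕ, j ≤ i :=
  Filter.Eventually.filter_mono Nat.hyperfilter_le_atTop (Filter.eventually_ge_atTop j)

end Ultrapower

/-! ### Finite chains of reflecting sets and their nonstandard limit. -/

section Chain

variable {M : Type} [Lset.Structure M]

local infix:50 " ε " => Mem

/-- The set `y` is transitive. -/
def Trans (y : M) : Prop :=
  ∀ u, u ε y → ∀ v, v ε u → v ε y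

/-- If an existential statement `∃ y, ψ(y, v)` with parameters in `B` is true, then it has a
witness in `C`. -/
def Collects (ψ : Σ q : ℕ, Lset.Formula (Option (Fin q))) (B C : M) : Prop :=
  ∀ v : Fin ψ.1 → M, (∀ i, v i ε B) → (∃ y, ψ.2.Realize (scons y v)) →
    ∃ y, y ε C ∧ ψ.2.Realize (scons y v)

theorem IsModelM.exists_range (hM : IsModelM M) :
    ∀ (n : ℕ) (u : Fin n → M), ∃ B, ∀ x, x ε B ↔ ∃ i, x = u i
  | 0, _ => hM.empty.imp fun _ h x => iff_of_false (h x) fun ⟨i, _⟩ => i.elim0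
  | n + 1, u => by
    obtain ⟨B, hB⟩ := hM.exists_range n fun i => u i.succ
    obtain ⟨a, ha⟩ := hM.pair (u 0) (u 0)
    obtain ⟨C, hC⟩ := hM.exists_union a B
    refine ⟨C, fun x => ?_⟩
    rw [hC, ha, hB, or_self, Fin.exists_fin_succ]

theorem Formula.lev_realize {s : Side} {k : ℕ} {α : Type} {φ : Lset.Formula α} (h : IsLevy s k φ) :
    Lev s k fun w : α → M => φ.Realize w :=
  (h.lev (M := M) (Sum.elim id Fin.elim0)).congr fun _ =>
    iff_of_eq (congrArg (BoundedFormula.Realize φ _) (Subsingleton.elim _ _))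

variable {m : ℕ}

theorem IsModelM.exists_collects (hM : IsModelM M) (hm : 1 ≤ m) (hC : HasStrongCollection M m)
    (e : ℕ → Σ q : ℕ, Lset.Formula (Option (Fin q))) (i : ℕ) (B : M) :
    ∃ C, ∀ j < i, IsLevy .sigma (m + 1) (e j).2 → Collects (e j) B C := by
  induction i with
  | zero => exact ⟨B, fun j hj => absurd hj (Nat.not_lt_zero j)⟩
  | succ i ih =>
    obtain ⟨C₁, hC₁⟩ := ih
    have : ∃ C₂, IsLevy .sigma (m + 1) (e i).2 → Collects (e i) B C₂ := by
      by_cases h : IsLevy .sigma (m + 1) (e i).2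
      · obtain ⟨C₂, hC₂⟩ := hM.exists_collecting hm hC (Formula.lev_realize h) B
        exact ⟨C₂, fun _ => hC₂⟩
      · exact ⟨B, fun h' => absurd h' h⟩
    obtain ⟨C₂, hC₂⟩ := this
    obtain ⟨C, hC⟩ := hM.exists_union C₁ C₂
    refine ⟨C, fun j hj hl v hv hy => ?_⟩
    rcases Nat.lt_succ_iff_lt_or_eq.1 hj with hj | rfl
    · obtain ⟨y, hy, h⟩ := hC₁ j hj hl v hv hy
      exact ⟨y, (hC y).2 (.inl hy), h⟩
    · obtain ⟨y, hy, h⟩ := hC₂ hl v hv hy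
      exact ⟨y, (hC y).2 (.inr hy), h⟩

theorem IsModelM.exists_next (hM : IsModelM M) (hm : 1 ≤ m) (hC : HasStrongCollection M m)
    (e : ℕ → Σ q : ℕ, Lset.Formula (Option (Fin q))) (i : ℕ) (B : M) :
    ∃ C : M, Trans C ∧ (∀ y, (∀ u, u ε y → u ε B) → y ε C) ∧
      ∀ j < i, IsLevy .sigma (m + 1) (e j).2 → Collects (e j) B C := by
  obtain ⟨C₁, hC₁⟩ := hM.exists_collects hm hC e i B
  obtain ⟨C₂, hC₂⟩ := hM.pow B
  obtain ⟨C₃, hC₃⟩ := hM.exists_union C₁ C₂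
  obtain ⟨C, hCt, hC⟩ := hM.trans C₃
  refine ⟨C, hCt, fun y hy => hC _ ((hC₃ y).2 (.inr ((hC₂ y).2 hy))), fun j hj hl v hv hy => ?_⟩
  obtain ⟨y, hy, h⟩ := hC₁ j hj hl v hv hy
  exact ⟨y, hC _ ((hC₃ y).2 (.inl hy)), h⟩

/-- The sequence is built by external recursion, so in general only an initial segment of it can be
asserted to form a set `H`. Likewise only the first `i` formulas are treated. The ultrapower removes
both restrictions. -/
theorem IsModelM.exists_chain (hM : IsModelM M) (hm : 1 ≤ m) (hC : HasStrongCollection M m)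
    (e : ℕ → Σ q : ℕ, Lset.Formula (Option (Fin q))) (B : M) (i : ℕ) :
    ∃ (c : ℕ → M) (H : M), (∀ u, u ε B → u ε c 0) ∧ (∀ t, Trans (c t)) ∧
      (∀ t y, (∀ u, u ε y → u ε c t) → y ε c (t + 1)) ∧
      (∀ t, ∀ j < i, IsLevy .sigma (m + 1) (e j).2 → Collects (e j) (c t) (c (t + 1))) ∧
      ∀ x, x ε H ↔ ∃ t ≤ i, x = c t := by
  choose next h₁ h₂ h₃ using hM.exists_next hm hC e i
  obtain ⟨B', hB't, hB'⟩ := hM.trans B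
  let c : ℕ → M := Nat.rec B' fun _ => next
  obtain ⟨H, hH⟩ := hM.exists_range (i + 1) fun t => c t
  refine ⟨c, H, hB', fun t => ?_, fun t => h₂ _, fun t => h₃ _, fun x => (hH x).trans ?_⟩
  · cases t
    exacts [hB't, h₁ _]
  · constructor
    · rintro ⟨t, rfl⟩
      exact ⟨t, Nat.lt_succ_iff.1 t.2, rfl⟩
    · rintro ⟨t, ht, rfl⟩
      exact ⟨⟨t, Nat.lt_succ_iff.2 ht⟩, rfl⟩

variable (m) in
/-- A descending `ω`-sequence of transitive sets, all of them members of a set `H` linearly ordered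
by membership, such that each term contains all subsets of the next one and witnesses for all true
existential `Σ_{m+1}` statements with parameters in the next one. -/
structure IsDescending (D : ℕ → M) (H : M) : Prop where
  trans (j : ℕ) : Trans (D j)
  mem_of_subset (j : ℕ) (y : M) : (∀ u, u ε y → u ε D (j + 1)) → y ε D j
  collects (j : ℕ) (ψ : Σ q : ℕ, Lset.Formula (Option (Fin q))) :
    IsLevy .sigma (m + 1) ψ.2 → Collects ψ (D (j + 1)) (D j)
  mem_H (j : ℕ) : D j ε H
  linear (x y : M) : x ε H → y ε H → x ε y ∨ x = y ∨ y ε x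

/-- In the ultrapower the chains of length `i` have a nonstandard top, and `D j` is the term `j`
steps below it. The `k`-th formula is treated in all chains with `i > k`, hence almost everywhere.
-/
theorem IsModelM.exists_isDescending (hM : IsModelM M) (hm : 1 ≤ m)
    (hC : HasStrongCollection M m) (B : M) :
    ∃ (N : Type) (_ : Lset.Structure N) (f : M → N) (D : ℕ → N) (H : N),
      (∀ {n : ℕ} (φ : Lset.BoundedFormula Empty n) (xs : Fin n → M),
        φ.Realize default (f ∘ xs) ↔ φ.Realize default xs) ∧
      (∀ u, u ε B → ∀ j, f u ε D j) ∧ IsDescending m D H := by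
  have : Nonempty M := ⟨B⟩
  obtain ⟨e, he⟩ := exists_surjective_nat (Σ q : ℕ, Lset.Formula (Option (Fin q)))
  choose c H hB hct hcs hcc hH using hM.exists_chain hm hC e B
  have hcs' (i t : ℕ) : c i t ε c i (t + 1) := hcs i t _ fun _ => id
  have hlt (i : ℕ) {s t : ℕ} (hst : s < t) : c i s ε c i t := by
    induction hst with
    | refl => exact hcs' i s
    | step _ ih => exact hct i _ _ (hcs' i _) _ ih
  have hle (i t u) (hu : u ε c i 0) : u ε c i t := by
    rcases t.eq_zero_or_pos with rfl | ht
    exacts [hu, hct i t _ (hlt i ht) u hu]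
  have hU := eventually_hyperfilter_ge
  -- For `i < j` truncated subtraction gives the bottom `c i 0`, which still contains `B` and
  -- belongs to `H i`; the successor properties are only used for `i ≥ j + 1`.
  let D : ℕ → ℕ → M := fun j i => c i (i - j)
  have hrep := Ultrapower.mk_surjective (M := M)
  refine ⟨Ultrapower M, inferInstance, fun u => Ultrapower.mk fun _ => u, fun j => Ultrapower.mk (D j), Ultrapower.mk H,
    fun {n} φ xs => ?_, fun u hu j => ?_, ⟨fun j => ?_, fun j y hy => ?_, fun j ψ hψ v hv hy => ?_,
    fun j => ?_, fun x y hx hy => ?_⟩⟩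
  · have h := Ultrapower.realize_mk φ (fun a : Empty => a.elim) fun i _ => xs i
    have h' (i : ℕ) : (fun a : Empty => (a.elim : ℕ → M) i) = default := Subsingleton.elim _ _
    simp only [h', Filter.eventually_const] at h
    rw [← h]
    exact iff_of_eq (congrArg₂ _ (Subsingleton.elim _ _) rfl)
  · exact Ultrapower.mk_mem_mk.2 (.of_forall fun i => hle i _ u (hB i u hu))
  · intro u hu v hv
    obtain ⟨u, rfl⟩ := hrep u
    obtain ⟨v, rfl⟩ := hrep v
    rw [Ultrapower.mk_mem_mk] at hu hv ⊢
    filter_upwards [hu, hv] with i hu hv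
    exact hct i _ _ hu _ hv
  · obtain ⟨y, rfl⟩ := hrep y
    rw [Ultrapower.mk_mem_mk]
    by_contra hn
    rw [← Ultrafilter.eventually_not] at hn
    -- If `y` were not in `D j`, then coordinatewise some element of `y` would be missing from `D (j
    -- + 1)`; the class of these elements contradicts the inclusion.
    have : ∀ i, ∃ u, ¬ y i ε D j i → j + 1 ≤ i → u ε y i ∧ ¬ u ε D (j + 1) i := by
      intro i
      by_contra! h
      obtain ⟨h₁, h₂, -⟩ := h (y i)
      refine h₁ ?_
      have : D j i = c i (i - (j + 1) + 1) := by
        simp only [D]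
        congr 1
        omega
      rw [this]
      exact hcs i _ _ fun u hu => by
        by_contra hu'
        obtain ⟨-, -, h₃⟩ := h u
        exact hu' (h₃ hu)
    choose u hu using this
    have h₁ := hy (Ultrapower.mk u) (Ultrapower.mk_mem_mk.2 (by
      filter_upwards [hn, hU (j + 1)] with i h₁ h₂ using (hu i h₁ h₂).1))
    rw [Ultrapower.mk_mem_mk] at h₁
    obtain ⟨i, h₁, h₂, h₃⟩ := (h₁.and (hn.and (hU (j + 1)))).exists
    exact (hu i h₂ h₃).2 h₁
  · obtain ⟨k, rfl⟩ := he ψ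
    choose v' hv' using fun i => hrep (v i)
    obtain rfl : v = fun i => Ultrapower.mk (v' i) := funext fun i => (hv' i).symm
    have hcons (y : ℕ → M) : (scons (Ultrapower.mk y) fun i => Ultrapower.mk (v' i)) =
        fun o => Ultrapower.mk (scons y v' o) := by
      funext o
      cases o <;> rfl
    have hcons' (y : ℕ → M) (i : ℕ) : (fun o => scons y v' o i) = scons (y i) fun j => v' j i := by
      funext o
      cases o <;> rfl
    have hrz (y : ℕ → M) : (e k).2.Realize (scons (Ultrapower.mk y) fun i => Ultrapower.mk (v' i)) ↔
        ∀ᶠ i in Filter.hyperfilter ℕ, (e k).2.Realize (scons (y i) fun j => v' j i) := by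
      have h := Ultrapower.realize_mk (e k).2 (scons y v') Fin.elim0
      rw [← hcons] at h
      simp only [hcons'] at h
      refine Iff.trans (iff_of_eq (congrArg (BoundedFormula.Realize (e k).2 _)
        (Subsingleton.elim _ _))) (h.trans ?_)
      refine Filter.eventually_congr (.of_forall fun i => iff_of_eq ?_)
      exact congrArg (BoundedFormula.Realize (e k).2 _) (Subsingleton.elim _ _)
    obtain ⟨y, hy⟩ := hy
    obtain ⟨y, rfl⟩ := hrep y
    rw [hrz] at hy
    simp only [Ultrapower.mk_mem_mk] at hv
    -- Witnesses are chosen coordinatewise; at the exceptional indices any value will do.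
    have : ∀ i, ∃ z, k < i → j + 1 ≤ i → (∀ l, v' l i ε D (j + 1) i) →
        (e k).2.Realize (scons (y i) fun j => v' j i) →
          z ε D j i ∧ (e k).2.Realize (scons z fun j => v' j i) := by
      intro i
      by_cases h : k < i ∧ j + 1 ≤ i ∧ (∀ l, v' l i ε D (j + 1) i) ∧
        (e k).2.Realize (scons (y i) fun j => v' j i)
      · obtain ⟨h₁, h₂, h₃, h₄⟩ := h
        obtain ⟨z, hz⟩ := hcc i (i - (j + 1)) k h₁ hψ (fun l => v' l i) h₃ ⟨_, h₄⟩
        rw [show i - (j + 1) + 1 = i - j by omega] at hz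
        exact ⟨z, fun _ _ _ _ => hz⟩
      · exact ⟨y i, fun h₁ h₂ h₃ h₄ => absurd ⟨h₁, h₂, h₃, h₄⟩ h⟩
    choose z hz using this
    have hv'' : ∀ᶠ i in Filter.hyperfilter ℕ, ∀ l, v' l i ε D (j + 1) i := Filter.eventually_all.2 hv
    refine ⟨Ultrapower.mk z, Ultrapower.mk_mem_mk.2 ?_, (hrz z).2 ?_⟩
    · filter_upwards [hy, hv'', hU (k + 1), hU (j + 1)] with i h₁ h₂ h₃ h₄ using
        (hz i h₃ h₄ h₂ h₁).1
    · filter_upwards [hy, hv'', hU (k + 1), hU (j + 1)] with i h₁ h₂ h₃ h₄ using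
        (hz i h₃ h₄ h₂ h₁).2
  · exact Ultrapower.mk_mem_mk.2 (.of_forall fun i => (hH i _).2 ⟨i - j, Nat.sub_le _ _, rfl⟩)
  · obtain ⟨x, rfl⟩ := hrep x
    obtain ⟨y, rfl⟩ := hrep y
    rw [Ultrapower.mk_mem_mk] at hx hy
    have : ∀ᶠ i in Filter.hyperfilter ℕ, x i ε y i ∨ x i = y i ∨ y i ε x i := by
      filter_upwards [hx, hy] with i hx hy
      obtain ⟨s, -, hs⟩ := (hH i _).1 hx
      obtain ⟨t, -, ht⟩ := (hH i _).1 hy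
      rw [hs, ht]
      rcases lt_trichotomy s t with h | rfl | h
      exacts [.inl (hlt i h), .inr (.inl rfl), .inr (.inr (hlt i h))]
    rw [Ultrafilter.eventually_or, Ultrafilter.eventually_or] at this
    rw [Ultrapower.mk_mem_mk, Ultrapower.mk_mem_mk]
    exact this.imp id (Or.imp Ultrapower.mk_eq_mk.2 id)

end Chain

end WeakSetTheory

namespace WeakSetTheory

/-! ### The core: elementarity, axioms and collection. -/

section Core

variable {N : Type} [Lset.Structure N] {ι : Type} {m : ℕ} {D : ℕ → N} {H : N}

local infix:50 " ε " => Mem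

/-- The intersection of a sequence of sets, as a structure. -/
def Core (D : ℕ → N) : Type :=
  {x : N // ∀ j, x ε D j}

/-- The inclusion of the intersection of a sequence of sets. -/
def Core.val (x : Core D) : N :=
  x.1

instance : Lset.Structure (Core D) :=
  structureOfRel fun x y => x.val ε y.val

theorem Core.mem_iff {x y : Core D} : x ε y ↔ x.val ε y.val :=
  Iff.rfl

theorem Core.val_injective : Function.Injective (Core.val (D := D)) :=
  Subtype.val_injective

theorem IsDescending.mem_core_of_mem (hD : IsDescending m D H) (x : Core D) {y : N}
    (hy : y ε x.val) : ∀ j, y ε D j :=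
  fun j => hD.trans j _ (x.2 j) y hy

/-- A subset of `D (j + 1)` is a member of `D j`. Hence a set formed in N from members of the core
stays in the core, although the core is only defined externally. -/
theorem IsDescending.mem_core_of_forall (hD : IsDescending m D H) {y : N}
    (hy : ∀ u, u ε y → ∀ j, u ε D j) (j : ℕ) : y ε D j :=
  hD.mem_of_subset j y fun u hu => hy u hu (j + 1)

/-- A `Δ₀` property of all the `D j` is shared by some set in their intersection. -/
theorem IsDescending.exists_core (hD : IsDescending m D H) (hN : IsModelM N) [Finite ι]
    {R : (ι → N) → N → Prop} (hR : D0 fun w : Option ι → N => R (fun i => w (some i)) (w none))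
    (v : ι → N) (h : ∀ j, R v (D j)) : ∃ d : Core D, R v d.val := by
  obtain ⟨E, hE⟩ := hN.exists_sep hR v H
  have hDE (j : ℕ) : D j ε E := (hE _).2 ⟨hD.mem_H j, h j⟩
  -- Each `D (j + 1)` is in `E`, so by minimality it is not a member of `d`; linearity of `H` then
  -- puts `d` at or below `D (j + 1)`, hence into `D j`.
  obtain ⟨d, hd, hmin⟩ := hN.found E ⟨D 0, hDE 0⟩
  obtain ⟨hdH, hRd⟩ := (hE d).1 hd
  refine ⟨⟨d, fun j => ?_⟩, hRd⟩
  have hj : D (j + 1) ε D j := hD.mem_of_subset j _ fun u => id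
  rcases hD.linear d (D (j + 1)) hdH (hD.mem_H _) with h | rfl | h
  · exact hD.trans j _ hj _ h
  · exact hj
  · exact absurd (hDE _) (hmin _ h)

/-- A true existential `Σ_{m+1}` statement with parameters in the intersection has a witness
there. -/
theorem IsDescending.exists_witness (hD : IsDescending m D H) (hm : 1 ≤ m) (hN : IsModelM N)
    (hC : HasStrongCollection N m) [Finite ι] {P : (Option ι → N) → Prop}
    (hP : Lev .sigma (m + 1) P) (v : ι → Core D) (h : ∃ y, P (scons y fun i => (v i).val)) :
    ∃ y : Core D, P (scons y.val fun i => (v i).val) := by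
  have hall (j : ℕ) : ∃ y, y ε D j ∧ P (scons y fun i => (v i).val) := by
    obtain ⟨q, ⟨e⟩⟩ := Finite.exists_equiv_fin ι
    obtain ⟨φ, hφ, hφP⟩ := hP.exists_formula (α := Option (Fin q)) (n := 0)
      fun o => .inl (o.map e)
    have hφP' (y : N) : φ.Realize (scons y fun k => (v (e.symm k)).val) (default : Fin 0 → N) ↔
        P (scons y fun i => (v i).val) := by
      rw [hφP]
      refine iff_of_eq (congrArg _ (funext fun o => ?_))
      cases o <;> simp
    obtain ⟨y, hy, hy'⟩ := hD.collects j ⟨q, φ⟩ hφ (fun k => (v (e.symm k)).val)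
      (fun k => (v _).2 _) (h.imp fun y => (hφP' y).2)
    exact ⟨y, hy, (hφP' y).1 hy'⟩
  -- Every `D j` contains a witness. Once `P` is replaced by a relation that is Δ₀ on `D 0`, this
  -- becomes a Δ₀ property of `D j`, to which `exists_core` applies.
  obtain ⟨κ, _, c, Q, hQ, hPQ⟩ := hN.exists_d0 hm hC le_rfl hP (D 0)
  have hPQ' (y : N) (hy : y ε D 0) := hPQ (scons y fun i => (v i).val) (by
    rintro (_ | i)
    exacts [hy, (v i).2 0])
  obtain ⟨d, y, hy, hy'⟩ := hD.exists_core hN (ι := ι ⊕ κ)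
    (R := fun w d => ∃ y, y ε d ∧ Q (Sum.elim (scons y fun i => w (.inl i)) fun k => w (.inr k)))
    (by
      refine D0.bex none ((hQ.relabel (Sum.elim (fun o => o.elim none fun i => some (some (.inl i)))
        fun k => some (some (.inr k)))).congr fun w => iff_of_eq (congrArg _ ?_))
      funext i
      rcases i with (_ | i) | k <;> rfl)
    (Sum.elim (fun i => (v i).val) c) fun j => by
      obtain ⟨y, hy, hy'⟩ := hall j
      have hy0 : y ε D 0 := by
        clear hy'
        induction j with
        | zero => exact hy
        | succ j ih => exact ih (hD.trans j _ (hD.mem_of_subset j _ fun u => id) _ hy)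
      exact ⟨y, hy, (hPQ' y hy0).1 hy'⟩
  have hyc := hD.mem_core_of_mem d hy
  exact ⟨⟨y, hyc⟩, (hPQ' y (hyc 0)).2 hy'⟩

theorem Core.comp_snoc {n : ℕ} (xs : Fin n → Core D) (x : Core D) :
    (Core.val ∘ (Fin.snoc xs x : Fin (n + 1) → Core D) : Fin (n + 1) → N) =
      Fin.snoc (Core.val ∘ xs) x.val :=
  Fin.comp_snoc _ _ _

theorem Core.sumElim_val {α : Type} {n : ℕ} (v : α → Core D) (xs : Fin n → Core D)
    (i : α ⊕ Fin n) : Sum.elim (Core.val ∘ v) (Core.val ∘ xs) i = (Sum.elim v xs i).val := by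
  cases i <;> rfl

/-- The core is transitive in N, so bounded quantifiers range over the same sets in both structures.
-/
theorem IsDescending.realize_iff_of_isDelta0 (hD : IsDescending m D H) {α : Type} {n : ℕ}
    {φ : Lset.BoundedFormula α n} (hφ : IsDelta0 φ) (v : α → Core D) (xs : Fin n → Core D) :
    φ.Realize v xs ↔ φ.Realize (Core.val ∘ v) (Core.val ∘ xs) := by
  induction hφ with
  | atomic h =>
    cases h with
    | equal t₁ t₂ =>
      obtain ⟨i, rfl⟩ := exists_eq_var t₁
      obtain ⟨j, rfl⟩ := exists_eq_var t₂
      simp only [BoundedFormula.realize_bdEqual, Term.realize_var, Core.sumElim_val,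
        Core.val_injective.eq_iff]
    | rel R ts =>
      cases R with
      | mem =>
        obtain ⟨i, hi⟩ := exists_eq_var (ts 0)
        obtain ⟨j, hj⟩ := exists_eq_var (ts 1)
        refine (BoundedFormula.realize_rel.trans (relMap_mem _)).trans
          (Iff.trans ?_ (BoundedFormula.realize_rel.trans (relMap_mem _)).symm)
        simp only [hi, hj, Term.realize_var, Core.sumElim_val]
        exact Core.mem_iff
  | falsum => exact Iff.rfl
  | imp _ _ ih₁ ih₂ => exact imp_congr (ih₁ xs) (ih₂ xs)
  | ball y _ ih =>
    simp only [BoundedFormula.realize_all, BoundedFormula.realize_imp, realize_guard, ih,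
      Core.comp_snoc, Core.sumElim_val, Core.mem_iff]
    exact ⟨fun h x hx => h ⟨x, hD.mem_core_of_mem _ hx⟩ hx, fun h x hx => h x.val hx⟩
  | bex y _ ih =>
    simp only [BoundedFormula.realize_ex, BoundedFormula.realize_inf, realize_guard, ih,
      Core.comp_snoc, Core.sumElim_val, Core.mem_iff]
    exact ⟨fun ⟨x, hx, h⟩ => ⟨x.val, hx, h⟩,
      fun ⟨x, hx, h⟩ => ⟨⟨x, hD.mem_core_of_mem _ hx⟩, hx, h⟩⟩

/-- The intersection is a `Σ_{m+1}`-elementary substructure. -/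
theorem IsDescending.realize_iff (hD : IsDescending m D H) (hm : 1 ≤ m) (hN : IsModelM N)
    (hC : HasStrongCollection N m) {α : Type} [Finite α] {s : Side} {k n : ℕ}
    {φ : Lset.BoundedFormula α n} (hφ : IsLevy s k φ) (hk : k ≤ m + 1) (v : α → Core D)
    (xs : Fin n → Core D) : φ.Realize v xs ↔ φ.Realize (Core.val ∘ v) (Core.val ∘ xs) := by
  have hlev {s : Side} {k n : ℕ} {φ : Lset.BoundedFormula α (n + 1)} (hφ : IsLevy s k φ)
      (xs : Fin n → Core D) : ∃ P : (Option (α ⊕ Fin n) → N) → Prop, Lev s k P ∧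
        ∀ x, P (scons x fun i => (Sum.elim v xs i).val) ↔
          φ.Realize (Core.val ∘ v) (Fin.snoc (Core.val ∘ xs) x) := by
    refine ⟨_, hφ.lev (M := N) (Sum.elim (fun a => some (.inl a))
      fun i => i.lastCases none fun i => some (.inr i)), fun x => ?_⟩
    refine iff_of_eq (congrArg₂ _ rfl (funext fun i => ?_))
    refine i.lastCases ?_ fun i => ?_ <;> simp
  induction hφ with
  | delta0 s h => exact hD.realize_iff_of_isDelta0 h v xs
  | sigma_of_pi _ ih => exact ih (by omega) xs
  | pi_of_sigma _ ih => exact ih (by omega) xs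
  | ex hφ ih =>
    simp only [BoundedFormula.realize_ex, ih hk, Core.comp_snoc]
    obtain ⟨P, hP, hPφ⟩ := hlev hφ xs
    simp only [← hPφ]
    exact ⟨fun ⟨x, hx⟩ => ⟨x.val, hx⟩, hD.exists_witness hm hN hC (hP.mono hk) _⟩
  | all hφ ih =>
    simp only [BoundedFormula.realize_all, ih hk, Core.comp_snoc]
    obtain ⟨P, hP, hPφ⟩ := hlev hφ xs
    simp only [← hPφ]
    refine ⟨fun h => ?_, fun h x => h x.val⟩
    by_contra! hn
    obtain ⟨x, hx⟩ := hD.exists_witness hm hN hC (hP.not.mono hk) _ hn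
    exact hx (h x)

/-- Upward persistence, one level beyond elementarity: the outer existential witnesses remain
available in N, and the Π_{m+1} matrix is absolute. -/
theorem IsDescending.realize_of_core (hD : IsDescending m D H) (hm : 1 ≤ m) (hN : IsModelM N)
    (hC : HasStrongCollection N m) {α : Type} [Finite α] {n : ℕ} {φ : Lset.BoundedFormula α n}
    (hφ : IsLevy .sigma (m + 2) φ) (v : α → Core D) (xs : Fin n → Core D)
    (h : φ.Realize v xs) : φ.Realize (Core.val ∘ v) (Core.val ∘ xs) := by
  generalize hs : Side.sigma = s, hl : m + 2 = l at hφ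
  induction hφ with
  | delta0 => cases hl
  | sigma_of_pi hφ =>
    obtain rfl : m + 1 = _ := Nat.succ.inj hl
    exact (hD.realize_iff hm hN hC hφ le_rfl v xs).1 h
  | pi_of_sigma => cases hs
  | ex _ ih =>
    obtain ⟨x, hx⟩ := BoundedFormula.realize_ex.1 h
    refine BoundedFormula.realize_ex.2 ⟨x.val, ?_⟩
    rw [← Core.comp_snoc]
    exact ih _ hx hs hl
  | all => cases hs

/-- Pairs, unions, differences, power sets and separated sets are computed in N and are subsets of
the core, hence members of it. The sets that N provides for transitive containment and infinity may
lie outside the core; but they are described by Δ₀ conditions, so `exists_witness` supplies others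
inside. -/
theorem IsDescending.isModelM_core (hD : IsDescending m D H) (hm : 1 ≤ m) (hN : IsModelM N)
    (hC : HasStrongCollection N m) : IsModelM (Core D) where
  ext x y h := Core.val_injective (hN.ext _ _ fun z =>
    ⟨fun hz => (h ⟨z, hD.mem_core_of_mem x hz⟩).1 hz,
      fun hz => (h ⟨z, hD.mem_core_of_mem y hz⟩).2 hz⟩)
  empty := by
    obtain ⟨x, hx⟩ := hN.empty
    exact ⟨⟨x, hD.mem_core_of_forall fun u hu => absurd hu (hx u)⟩, fun y => hx y.val⟩
  pair x y := by
    obtain ⟨z, hz⟩ := hN.pair x.val y.val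
    refine ⟨⟨z, hD.mem_core_of_forall fun u hu => ?_⟩, fun u => ?_⟩
    · rcases (hz u).1 hu with rfl | rfl
      exacts [x.2, y.2]
    · exact (hz u.val).trans (by simp only [Core.val_injective.eq_iff])
  union x := by
    obtain ⟨y, hy⟩ := hN.union x.val
    refine ⟨⟨y, hD.mem_core_of_forall fun u hu => ?_⟩, fun z => (hy z.val).trans ?_⟩
    · obtain ⟨w, hw, hu⟩ := (hy u).1 hu
      exact hD.mem_core_of_mem ⟨w, hD.mem_core_of_mem x hw⟩ hu
    · exact ⟨fun ⟨u, hu, hz⟩ => ⟨⟨u, hD.mem_core_of_mem x hu⟩, hu, hz⟩,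
        fun ⟨u, hu, hz⟩ => ⟨u.val, hu, hz⟩⟩
  diff x y := by
    obtain ⟨z, hz⟩ := hN.diff x.val y.val
    exact ⟨⟨z, hD.mem_core_of_forall fun u hu => hD.mem_core_of_mem x ((hz u).1 hu).1⟩,
      fun u => hz u.val⟩
  pow x := by
    obtain ⟨y, hy⟩ := hN.pow x.val
    refine ⟨⟨y, hD.mem_core_of_forall fun u hu => hD.mem_core_of_forall fun w hw =>
      hD.mem_core_of_mem x ((hy u).1 hu w hw)⟩, fun z => (hy z.val).trans ?_⟩
    exact ⟨fun h u hu => h u.val hu, fun h u hu => h ⟨u, hD.mem_core_of_mem z hu⟩ hu⟩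
  trans x := by
    have hd0 : D0 fun w : Option Unit → N => (∀ u, u ε w none → ∀ v, v ε u → v ε w none) ∧
        ∀ u, u ε w (some ()) → u ε w none :=
      (D0.ball none (R := fun w u => ∀ v, v ε u → v ε w none)
        (D0.ball none (D0.mem none (some (some none))))).and
          (D0.ball (some ()) (D0.mem none (some none)))
    obtain ⟨y, hy, hxy⟩ := hD.exists_witness hm hN hC (Lev.of_d0 hd0 _ _) (fun _ => x)
      (hN.trans x.val)
    exact ⟨y, fun u hu v hv => hy u.val hu v.val hv, fun u hu => hxy u.val hu⟩
  inf := by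
    have hd0 : D0 fun w : Option Empty → N => (∃ y, y ε w none ∧ ∀ u, u ε y → False) ∧
        ∀ y, y ε w none → ∃ z, z ε w none ∧ (∀ u, u ε z → u ε y ∨ u = y) ∧
          (∀ u, u ε y → u ε z) ∧ y ε z := by
      refine (D0.bex none (R := fun _ y => ∀ u, u ε y → False) (D0.ball none D0.falsum)).and
        (D0.ball none (R := fun w y => ∃ z, z ε w none ∧ (∀ u, u ε z → u ε y ∨ u = y) ∧
          (∀ u, u ε y → u ε z) ∧ y ε z) (D0.bex (some none) ?_))
      exact (D0.ball none ((D0.mem none (some (some none))).or (D0.eq none (some (some none))))).and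
        ((D0.ball (some none) (D0.mem none (some none))).and (D0.mem (some none) none))
    obtain ⟨x, ⟨e, he, he'⟩, hx⟩ := hN.inf
    obtain ⟨x, ⟨e, he, he'⟩, hx⟩ := hD.exists_witness hm hN hC (Lev.of_d0 hd0 _ _)
      (fun a : Empty => a.elim) ⟨x, ⟨e, he, he'⟩, fun y hy => by
        obtain ⟨z, hz, hz'⟩ := hx y hy
        exact ⟨z, hz, fun u => (hz' u).1, fun u hu => (hz' u).2 (.inl hu), (hz' y).2 (.inr rfl)⟩⟩
    refine ⟨x, ⟨⟨e, hD.mem_core_of_mem x he⟩, he, fun u => he' u.val⟩, fun y hy => ?_⟩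
    obtain ⟨z, hz, h₁, h₂, h₃⟩ := hx y.val hy
    refine ⟨⟨z, hD.mem_core_of_mem x hz⟩, hz, fun u => ⟨fun hu => ?_, ?_⟩⟩
    · exact (h₁ u.val hu).imp id fun h => Core.val_injective h
    · rintro (hu | rfl)
      exacts [h₂ u.val hu, h₃]
  found z := by
    rintro ⟨x, hx⟩
    obtain ⟨y, hy, hyz⟩ := hN.found z.val ⟨x.val, hx⟩
    exact ⟨⟨y, hD.mem_core_of_mem z hy⟩, hy, fun x hx => hyz x.val hx⟩
  sep p φ hφ c w := by
    obtain ⟨y, hy⟩ := hN.sep p φ hφ (Core.val ∘ c) w.val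
    refine ⟨⟨y, hD.mem_core_of_forall fun u hu => hD.mem_core_of_mem w ((hy u).1 hu).1⟩,
      fun x => (hy x.val).trans (and_congr_right fun _ => ?_)⟩
    refine Iff.trans (iff_of_eq (congrArg₂ (BoundedFormula.Realize φ) ?_ (Subsingleton.elim _ _)))
      (hD.realize_iff_of_isDelta0 hφ (Sum.elim c ![x]) default).symm
    funext i
    rcases i with i | i
    · rfl
    · fin_cases i
      rfl

theorem IsDescending.hasChoice_core (hD : IsDescending m D H) (hN : IsModelM N)
    (h : HasChoice N) : HasChoice (Core D) := by
  rintro x ⟨hne, hdisj⟩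
  obtain ⟨c, hc⟩ := h x.val ⟨fun u hu => by
    obtain ⟨y, hy⟩ := hne ⟨u, hD.mem_core_of_mem x hu⟩ hu
    exact ⟨y.val, hy⟩, fun u v ⟨hu, hv⟩ ⟨y, hyu, hyv⟩ => by
    have hu' := hD.mem_core_of_mem x hu
    exact congrArg Core.val (hdisj ⟨u, hu'⟩ ⟨v, hD.mem_core_of_mem x hv⟩ ⟨hu, hv⟩
      ⟨⟨y, hD.mem_core_of_mem ⟨u, hu'⟩ hyu⟩, hyu, hyv⟩)⟩
  -- The choice set of N may have elements outside the core; it is cut down to the union of `x`, the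
  -- intersection being a double difference.
  obtain ⟨a, ha⟩ := hN.union x.val
  obtain ⟨b, hb⟩ := hN.diff a c
  obtain ⟨d, hd⟩ := hN.diff a b
  have hd' (y : N) : y ε d ↔ y ε a ∧ y ε c := by grind
  refine ⟨⟨d, hD.mem_core_of_forall fun u hu => ?_⟩, fun u hu => ?_⟩
  · obtain ⟨w, hw, hu⟩ := (ha u).1 ((hd' u).1 hu).1
    exact hD.mem_core_of_mem ⟨w, hD.mem_core_of_mem x hw⟩ hu
  · obtain ⟨y, ⟨hyc, hyu⟩, hy⟩ := hc u.val hu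
    refine ⟨⟨y, hD.mem_core_of_mem u hyu⟩,
      ⟨(hd' y).2 ⟨(ha y).2 ⟨u.val, hu, hyu⟩, hyc⟩, hyu⟩, fun z ⟨hzd, hzu⟩ =>
        Core.val_injective (hy z.val ⟨((hd' _).1 hzd).2, hzu⟩)⟩

/-- Witnesses in the core belong to every `D j`, so each `D j` is a collecting set for `w`. With φ
made Δ₀ on `D 0`, being a collecting set is a Δ₀ property, and `exists_core` finds one in the core.
-/
theorem IsDescending.hasCollection_core (hD : IsDescending m D H) (hm : 1 ≤ m) (hN : IsModelM N)
    (hC : HasStrongCollection N m) : HasCollection (Core D) (m + 1) := by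
  intro p φ hφ c w h
  obtain ⟨κ, _, a, Q, hQ, hφQ⟩ := hN.exists_d0 hm hC le_rfl (Formula.lev_realize (M := N) hφ) (D 0)
  have key (x y : Core D) : φ.Realize (Sum.elim c ![x, y]) ↔
      Q (Sum.elim (Sum.elim (fun i => (c i).val) ![x.val, y.val]) a) := by
    rw [← hφQ]
    · refine (hD.realize_iff hm hN hC hφ le_rfl _ _).trans
        (iff_of_eq (congrArg₂ _ ?_ (Subsingleton.elim _ _)))
      funext i
      rcases i with i | i
      · rfl
      · fin_cases i <;> rfl
    · rintro (i | i)
      · exact (c i).2 0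
      · fin_cases i
        exacts [x.2 0, y.2 0]
  obtain ⟨C, hC⟩ := hD.exists_core hN (ι := Option (Fin p ⊕ κ))
    (R := fun v d => ∀ x, x ε v none → ∃ y, y ε d ∧ Q (Sum.elim
      (Sum.elim (fun i => v (some (.inl i))) ![x, y]) fun k => v (some (.inr k))))
    (by
      refine D0.ball (some none) (D0.bex (some none) ((hQ.relabel (Sum.elim (Sum.elim
        (fun i => some (some (some (some (.inl i))))) ![some none, none])
          fun k => some (some (some (some (.inr k)))))).congr fun w => iff_of_eq (congrArg _ ?_)))
      funext i
      rcases i with (i | i) | k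
      · rfl
      · fin_cases i <;> rfl
      · rfl)
    (scons w.val (Sum.elim (fun i => (c i).val) a)) fun j x hx => by
      obtain ⟨y, hy⟩ := h ⟨x, hD.mem_core_of_mem w hx⟩ hx
      exact ⟨y.val, y.2 j, (key _ _).1 hy⟩
  refine ⟨C, fun x hx => ?_⟩
  obtain ⟨y, hy, hQy⟩ := hC x.val hx
  exact ⟨⟨y, hD.mem_core_of_mem C hy⟩, hy, (key _ _).2 hQy⟩

end Core

end WeakSetTheory

namespace WeakSetTheory

/-! ### Transfer of counterexamples and conservativity. -/

section Conservativity

variable {M : Type} [Lset.Structure M] {m : ℕ}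

local infix:50 " ε " => Mem

/-- If a `Π_{k+1}` formula fails, then instances of its outer quantifiers make a `Σ_k` formula
fail. -/
theorem exists_counterexample {k n : ℕ} {φ : Lset.BoundedFormula Empty n}
    (hφ : IsLevy .pi (k + 1) φ) {xs : Fin n → M} (h : ¬ φ.Realize default xs) :
    ∃ (l : ℕ) (χ : Lset.BoundedFormula Empty l) (ys : Fin l → M), IsLevy .sigma k χ ∧
      ¬ χ.Realize default ys ∧ ∀ (K : Type) [Lset.Structure K] (zs : Fin l → K),
        ¬ χ.Realize default zs → ∃ ws : Fin n → K, ¬ φ.Realize default ws := by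
  generalize hs : Side.pi = s, hl : k + 1 = l at hφ
  induction hφ with
  | delta0 => cases hl
  | sigma_of_pi => cases hs
  | @pi_of_sigma _ n φ hφ =>
    obtain rfl : k = _ := Nat.succ.inj hl
    exact ⟨n, φ, xs, hφ, h, fun K _ zs hz => ⟨zs, hz⟩⟩
  | ex => cases hs
  | all _ ih =>
    rw [BoundedFormula.realize_all, not_forall] at h
    obtain ⟨x, hx⟩ := h
    obtain ⟨l, χ, ys, hχ, hys, hK⟩ := ih hx hs hl
    refine ⟨l, χ, ys, hχ, hys, fun K _ zs hz => ?_⟩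
    obtain ⟨ws, hws⟩ := hK K zs hz
    refine ⟨Fin.init ws, fun hall => hws ?_⟩
    have := BoundedFormula.realize_all.1 hall (ws (Fin.last _))
    rwa [Fin.snoc_init_self] at this

/-- A `Π_{m+3}` sentence that fails in a model of `M` with strong `Π_m`-collection fails in a model
of `M` with `Π_{m+1}`-collection. -/
theorem IsModelM.exists_model_hasCollection (hM : IsModelM M) (hm : 1 ≤ m)
    (hC : HasStrongCollection M m) {σ : Lset.Sentence} (hσ : IsPi (m + 3) σ) (h : ¬ M ⊨ σ) :
    ∃ (K : Type) (_ : Lset.Structure K), IsModelM K ∧ HasCollection K (m + 1) ∧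
      (HasChoice M → HasChoice K) ∧ ¬ K ⊨ σ := by
  obtain ⟨l, χ, ys, hχ, hys, hK⟩ := exists_counterexample (k := m + 2) hσ (xs := default) h
  obtain ⟨B, hB⟩ := hM.exists_range l ys
  obtain ⟨N, _, f, D, H, hf, hfD, hD⟩ := hM.exists_isDescending hm hC B
  have hMN (τ : Lset.Sentence) : N ⊨ τ ↔ M ⊨ τ :=
    (iff_of_eq (congrArg (BoundedFormula.Realize τ _) (Subsingleton.elim _ _))).trans (hf τ default)
  have hN : IsModelM N := model_theoryM_iff.1 ((Theory.model_iff _).2 fun τ hτ =>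
    (hMN τ).2 ((Theory.model_iff _).1 (model_theoryM_iff.2 hM) τ hτ))
  have hCN : HasStrongCollection N m := model_strongPiCollection_iff.1 ((Theory.model_iff _).2
    fun τ hτ => (hMN τ).2 ((Theory.model_iff _).1 (model_strongPiCollection_iff.2 hC) τ hτ))
  refine ⟨Core D, inferInstance, hD.isModelM_core hm hN hCN, hD.hasCollection_core hm hN hCN,
    fun hAC => hD.hasChoice_core hN (model_choice_iff.1 ((hMN _).2 (model_choice_iff.2 hAC))), ?_⟩
  let zs : Fin l → Core D := fun i => ⟨f (ys i), hfD _ ((hB _).2 ⟨i, rfl⟩)⟩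
  -- If χ held in the core it would hold in N by persistence, hence in M by elementarity of the
  -- ultrapower embedding.
  obtain ⟨ws, hws⟩ := hK (Core D) zs fun hz => hys ((hf χ ys).1 (by
    have := hD.realize_of_core hm hN hCN hχ default zs hz
    rwa [Subsingleton.elim (Core.val ∘ (default : Empty → Core D)) default] at this))
  rw [Subsingleton.elim ws default] at hws
  exact hws

/-- Treats both base theories at once: all that matters about `A` is that it includes M and passes
to models of M that inherit choice. -/
theorem conservativeOver_of_forall_model (hm : 1 ≤ m) {A : Lset.Theory}
    (hA : ∀ (M : Type) [Lset.Structure M], M ⊨ A → IsModelM M)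
    (hA' : ∀ (M K : Type) [Lset.Structure M] [Lset.Structure K], M ⊨ A → IsModelM K →
      (HasChoice M → HasChoice K) → K ⊨ A) :
    Theory.ConservativeOver (IsPi (m + 3)) (A ∪ piCollection (m + 1))
      (A ∪ strongPiCollection m) := by
  intro σ hσ
  simp only [proves_iff_forall_model, Theory.model_union_iff, model_piCollection_iff,
    model_strongPiCollection_iff]
  constructor
  · rintro h M _ _ ⟨hMA, hC⟩
    by_contra hn
    obtain ⟨K, _, hK, hKC, hAC, hKσ⟩ := (hA M hMA).exists_model_hasCollection hm hC hσ hn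
    have : Nonempty K := hK.empty.nonempty
    exact hKσ (h K ⟨hA' M K hMA hK hAC, hKC⟩)
  · rintro h M _ _ ⟨hMA, hC⟩
    exact h M ⟨hMA, hC.hasStrongCollection⟩

end Conservativity

end WeakSetTheory

theorem mainTheorem1 (m : ℕ) (hm : 1 ≤ m) :
    FirstOrder.Language.Theory.ConservativeOver (WeakSetTheory.IsPi (m + 3))
      (WeakSetTheory.theoryM ∪ WeakSetTheory.piCollection (m + 1))
      (WeakSetTheory.theoryM ∪ WeakSetTheory.strongPiCollection m) ∧
    FirstOrder.Language.Theory.ConservativeOver (WeakSetTheory.IsPi (m + 3))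
      (WeakSetTheory.theoryMac ∪ WeakSetTheory.piCollection (m + 1))
      (WeakSetTheory.theoryMac ∪ WeakSetTheory.strongPiCollection m) := by
  constructor
  · exact WeakSetTheory.conservativeOver_of_forall_model hm
      (fun _ _ h => WeakSetTheory.model_theoryM_iff.1 h)
      fun _ _ _ _ _ hK _ => WeakSetTheory.model_theoryM_iff.2 hK
  · refine WeakSetTheory.conservativeOver_of_forall_model hm (fun M _ h => ?_)
      fun M K _ _ h hK hAC => ?_
    · exact WeakSetTheory.model_theoryM_iff.1 (Theory.model_union_iff.1 h).1
    · refine Theory.model_union_iff.2 ⟨WeakSetTheory.model_theoryM_iff.2 hK, ?_⟩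
      rw [Theory.model_singleton_iff, WeakSetTheory.model_choice_iff]
      exact hAC (WeakSetTheory.model_choice_iff.1
        (Theory.model_singleton_iff.1 (Theory.model_union_iff.1 h).2))
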